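/- Let $\mathbf{k}$ be a field of characteristic zero and let $V=\bigoplus_{p\in\mathbb{Z}}V^p$ be a $\mathbb{Z}$-graded $\mathbf{k}$-vector space. For homogeneous elements $w_1,\dots,w_n$ of a graded vector space and $\sigma\in\mathfrak{S}_n$, let $\varepsilon(\sigma)=\prod_{a<b,\ \sigma(a)>\sigma(b)}(-1)^{|w_{\sigma(a)}||w_{\sigma(b)}|}$ be the Koszul sign and $\chi(\sigma)=\operatorname{sgn}(\sigma)\varepsilon(\sigma)$. Let $\mathfrak{S}_{(i,n-i)}$ be the set of $\sigma\in\mathfrak{S}_n$ with $\sigma(1)<\dots<\sigma(i)$ and $\sigma(i+1)<\dots<\sigma(n)$. An *$L_\infty$-algebra structure* on $V$ is a system of linear maps $l_k:V^{\otimes k}\to V$, $k\ge 1$, of degree $2-k$, such that for all homogeneous elements $l_k(v_{\sigma(1)},\dots,v_{\sigma(k)})=\chi(\sigma)\,l_k(v_1,\dots,v_k)$ for every $\sigma\in\mathfrak{S}_k$, and, for every $n\ge1$, $$\sum_{i+j=n+1}(-1)^i\sum_{\sigma\in\mathfrak{S}_{(i,n-i)}}\chi(\sigma)\,l_j\bigl(l_i(v_{\sigma(1)},\dots,v_{\sigma(i)}),v_{\sigma(i+1)},\dots,v_{\sigma(n)}\bigr)=0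 .$$ For a graded vector space $W$, let ${}^c\!\wedge(W)=\bigoplus_{n\ge1}\wedge^nW$, where $\wedge^nW$ is the quotient of $W^{\otimes n}$ by the relations $w_1\otimes\cdots\otimes w_n=\varepsilon(\sigma)\,w_{\sigma(1)}\otimes\cdots\otimes w_{\sigma(n)}$ ($w_i$ homogeneous, $\sigma\in\mathfrak S_n$), with the comultiplication $$\Delta(w_1\wedge\dots\wedge w_n)=\sum_{i=1}^{n-1}\sum_{\sigma\in\mathfrak{S}_{(i,n-i)}}\varepsilon(\sigma)\,(w_{\sigma(1)}\wedge\dots\wedge w_{\sigma(i)})\otimes(w_{\sigma(i+1)}\wedge\dots\wedge w_{\sigma(n)}) .$$ A *differential* on ${}^c\!\wedge(W)$ is a linear map $\theta$ of degree $1$ with $\Delta\theta=(\theta\otimes\mathrm{id})\Delta+(\mathrm{id}\otimes\theta)\Delta$, where $(\mathrm{id}\otimes\theta)(a\otimes b)=(-1)^{|a|}a\otimes\theta(b)$, and $\theta\circ\theta=0$. Its $n$-th *corestriction* is the composite $f_n:\wedge^nW\hookrightarrow{}^c\!\wedge(W)\xrightarrow{\ \theta\ }{}^c\!\wedge(W)\twoheadrightarrow\wedge^1W=W$.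 Let $\downarrow V$ be the desuspension, $(\downarrow V)^p=V^{p+1}$, with the tautological degree $-1$ map $\downarrow:V\to\,\downarrow V$. **Theorem.** There is a bijection between the set of $L_\infty$-algebra structures on $V$ and the set of differentials on ${}^c\!\wedge(\downarrow V)$, such that the structure $(l_1,l_2,\dots)$ corresponding to the differential with corestrictions $f_1,f_2,\dots$ is given, for every $n\ge1$ and all homogeneous $v_1,\dots,v_n\in V$, by $$\downarrow l_n(v_1,\dots,v_n)=(-1)^{\binom{n+1}{2}}\,(-1)^{\sum_{i=1}^n(n-i)|v_i|}\,f_n(\downarrow v_1\wedge\dots\wedge\downarrow v_n),$$ that is, $\downarrow\circ\, l_n=(-1)^{\binom{n+1}{2}}f_n\circ\downarrow^{\otimes n}$. -/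

import Mathlib

noncomputable section

open scoped TensorProduct DirectSum

namespace LInfty

/-! ### Koszul signs and unshuffles -/

/-- The Koszul sign `ε(σ)` for `n` homogeneous elements of degrees `d 0, …, d (n-1)`: the product of
`(-1)^{d (σ a) d (σ b)}` over all inversions `a < b`, `σ b < σ a` of `σ`. It is the sign with
`w₁ ∧ ⋯ ∧ wₙ = ε(σ) w_{σ 1} ∧ ⋯ ∧ w_{σ n}`. -/
def koszul {n : ℕ} (σ : Equiv.Perm (Fin n)) (d : Fin n → ℤ) : ℤˣ :=
  ∏ a, ∏ b, if a < b ∧ σ b < σ a then (d (σ a) * d (σ b)).negOnePow else 1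

/-- The antisymmetric Koszul sign `χ(σ) = sgn(σ) ε(σ)`. -/
def antiKoszul {n : ℕ} (σ : Equiv.Perm (Fin n)) (d : Fin n → ℤ) : ℤˣ :=
  Equiv.Perm.sign σ * koszul σ d

/-- The splitting of `n` positions into the first `i` ones and the last `n - i` ones. -/
def split (i n : ℕ) (h : i ≤ n) : Fin i ⊕ Fin (n - i) ≃ Fin n :=
  finSumFinEquiv.trans (finCongr (Nat.add_sub_cancel' h))

/-- The `(i, n-i)`-unshuffles: permutations which are increasing on the first `i` positions and
increasing on the last `n - i` positions. -/
def unshuffles (i n : ℕ) (h : i ≤ n) : Finset (Equiv.Perm (Fin n)) :=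
  Finset.univ.filter fun σ =>
    (∀ a b : Fin i, a < b → σ (split i n h (Sum.inl a)) < σ (split i n h (Sum.inl b))) ∧
    (∀ a b : Fin (n - i), a < b → σ (split i n h (Sum.inr a)) < σ (split i n h (Sum.inr b)))

section signs

variable {n : ℕ}

lemma prod_order_eq (r : Fin n → Fin n → ℤˣ) (hr : ∀ a b, r a b = r b a)
    (τ : Equiv.Perm (Fin n)) :
    (∏ a, ∏ b, if τ a < τ b then r a b else 1) = ∏ a, ∏ b, if a < b then r a b else 1 := by
  have h1 : (∏ a, ∏ b, if τ a < τ b then r a b else 1)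
      = (∏ a, ∏ b, if τ a < τ b ∧ a < b then r a b else 1) *
        ∏ a, ∏ b, if τ a < τ b ∧ b < a then r a b else 1 := by
    simp only [← Finset.prod_mul_distrib]
    refine Finset.prod_congr rfl fun a _ => Finset.prod_congr rfl fun b _ => ?_
    rcases lt_trichotomy a b with h | h | h
    · simp [h, h.not_gt]
    · subst h; simp
    · simp [h, h.not_gt]
  have h2 : (∏ a, ∏ b, if τ a < τ b ∧ b < a then r a b else 1)
      = ∏ a, ∏ b, if τ b < τ a ∧ a < b then r a b else 1 := by
    rw [Finset.prod_comm]
    refine Finset.prod_congr rfl fun a _ => Finset.prod_congr rfl fun b _ => ?_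
    rw [hr b a]
  rw [h1, h2]
  simp only [← Finset.prod_mul_distrib]
  refine Finset.prod_congr rfl fun a _ => Finset.prod_congr rfl fun b _ => ?_
  by_cases hab : a < b
  · have : τ a ≠ τ b := fun h => hab.ne (τ.injective h)
    rcases lt_or_gt_of_ne this with h | h
    · simp [h, h.not_gt, hab]
    · simp [h, h.not_gt, hab]
  · simp [hab]

lemma koszul_mul (τ σ : Equiv.Perm (Fin n)) (d : Fin n → ℤ) :
    koszul (τ * σ) d = koszul τ d * koszul σ (d ∘ τ) := by
  set h : Fin n → Fin n → ℤˣ := fun a b => (d (τ (σ a)) * d (τ (σ b))).negOnePow with hh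
  have hsymm : ∀ a b, h a b = h b a := fun a b => by simp only [hh, mul_comm]
  set k : Fin n → Fin n → ℤˣ := fun a b =>
    if (σ a < σ b ∧ τ (σ b) < τ (σ a)) ∨ (σ b < σ a ∧ τ (σ a) < τ (σ b)) then h a b else 1 with hk
  have ksymm : ∀ a b, k a b = k b a := fun a b => by
    simp only [hk]
    rw [hsymm a b]
    congr 1
    exact propext or_comm
  have h1 : koszul τ d = ∏ a, ∏ b, if a < b then k a b else 1 := by
    rw [← prod_order_eq k ksymm σ]
    unfold koszul
    rw [← Equiv.prod_comp σ]
    refine Finset.prod_congr rfl fun a _ => ?_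
    rw [← Equiv.prod_comp σ]
    refine Finset.prod_congr rfl fun b _ => ?_
    by_cases hab : σ a < σ b
    · simp [hk, hh, hab, hab.not_gt]
    · simp [hab]
  rw [h1]
  unfold koszul
  simp only [← Finset.prod_mul_distrib]
  refine Finset.prod_congr rfl fun a _ => Finset.prod_congr rfl fun b _ => ?_
  by_cases hab : a < b
  · have n1 : σ a ≠ σ b := fun e => hab.ne (σ.injective e)
    have n2 : τ (σ a) ≠ τ (σ b) := fun e => n1 (τ.injective e)
    rcases lt_or_gt_of_ne n1 with h3 | h3 <;> rcases lt_or_gt_of_ne n2 with h4 | h4 <;>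
      simp [hk, hh, hab, h3, h4, h3.not_gt, h4.not_gt]
  · simp [hab]

lemma koszul_one (d : Fin n → ℤ) : koszul 1 d = 1 := by
  unfold koszul
  refine Finset.prod_eq_one fun a _ => Finset.prod_eq_one fun b _ => ?_
  rw [if_neg]
  rintro ⟨h1, h2⟩
  exact lt_asymm h1 h2

/-- The block permutation acting by `π₁` on the first `i` and by `π₂` on the last positions. -/
def block {i n : ℕ} (h : i ≤ n) (π₁ : Equiv.Perm (Fin i)) (π₂ : Equiv.Perm (Fin (n - i))) :
    Equiv.Perm (Fin n) :=
  (split i n h).permCongr (Equiv.Perm.sumCongr π₁ π₂)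

lemma block_inl {i n : ℕ} (h : i ≤ n) (π₁ : Equiv.Perm (Fin i)) (π₂ : Equiv.Perm (Fin (n - i)))
    (a : Fin i) : block h π₁ π₂ (split i n h (Sum.inl a)) = split i n h (Sum.inl (π₁ a)) := by
  simp [block, Equiv.permCongr_apply]

lemma block_inr {i n : ℕ} (h : i ≤ n) (π₁ : Equiv.Perm (Fin i)) (π₂ : Equiv.Perm (Fin (n - i)))
    (a : Fin (n - i)) : block h π₁ π₂ (split i n h (Sum.inr a)) = split i n h (Sum.inr (π₂ a)) := by
  simp [block, Equiv.permCongr_apply]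

lemma split_inl_val {i n : ℕ} (h : i ≤ n) (a : Fin i) : (split i n h (Sum.inl a)).val = a := by
  simp [split]

lemma split_inr_val {i n : ℕ} (h : i ≤ n) (a : Fin (n - i)) :
    (split i n h (Sum.inr a)).val = i + a := by
  simp [split]

lemma koszul_block {i n : ℕ} (h : i ≤ n) (π₁ : Equiv.Perm (Fin i))
    (π₂ : Equiv.Perm (Fin (n - i))) (d : Fin n → ℤ) :
    koszul (block h π₁ π₂) d =
      koszul π₁ (fun a => d (split i n h (Sum.inl a))) *
        koszul π₂ (fun a => d (split i n h (Sum.inr a))) := by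
  unfold koszul
  rw [← Equiv.prod_comp (split i n h), Fintype.prod_sum_type]
  congr 1
  · refine Finset.prod_congr rfl fun a _ => ?_
    rw [← Equiv.prod_comp (split i n h), Fintype.prod_sum_type]
    rw [Finset.prod_eq_one (s := (Finset.univ : Finset (Fin (n - i)))), mul_one]
    · refine Finset.prod_congr rfl fun b _ => ?_
      simp only [block_inl, Fin.lt_def, split_inl_val]
    · intro b _
      rw [if_neg]
      simp only [block_inl, block_inr, Fin.lt_def, split_inl_val, split_inr_val]
      omega
  · refine Finset.prod_congr rfl fun a _ => ?_
    rw [← Equiv.prod_comp (split i n h), Fintype.prod_sum_type]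
    rw [Finset.prod_eq_one (s := (Finset.univ : Finset (Fin i))), one_mul]
    · refine Finset.prod_congr rfl fun b _ => ?_
      simp only [block_inr, Fin.lt_def, split_inr_val, add_lt_add_iff_left]
    · intro b _
      rw [if_neg]
      simp only [block_inl, block_inr, Fin.lt_def, split_inl_val, split_inr_val]
      omega

lemma exists_sort {i : ℕ} {α : Type*} [LinearOrder α] (f : Fin i → α) (hf : Function.Injective f) :
    ∃ π : Equiv.Perm (Fin i), ∀ a b, a < b → f (π a) < f (π b) := by
  refine ⟨Tuple.sort f, fun a b hab => ?_⟩
  exact ((Tuple.monotone_sort f).strictMono_of_injective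
    (hf.comp (Tuple.sort f).injective)) hab

lemma exists_unshuffle {i n : ℕ} (h : i ≤ n) (ρ : Equiv.Perm (Fin n)) :
    ∃ π₁ π₂, ρ * block h π₁ π₂ ∈ unshuffles i n h := by
  obtain ⟨π₁, h1⟩ := exists_sort (fun a => ρ (split i n h (Sum.inl a)))
    (fun a b hab => by simpa using hab)
  obtain ⟨π₂, h2⟩ := exists_sort (fun a => ρ (split i n h (Sum.inr a)))
    (fun a b hab => by simpa using hab)
  refine ⟨π₁, π₂, ?_⟩
  simp only [unshuffles, Finset.mem_filter, Finset.mem_univ, true_and, Equiv.Perm.mul_apply,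
    block_inl, block_inr]
  exact ⟨h1, h2⟩

lemma block_mul {i n : ℕ} (h : i ≤ n) (π₁ π₁' : Equiv.Perm (Fin i))
    (π₂ π₂' : Equiv.Perm (Fin (n - i))) :
    block h π₁ π₂ * block h π₁' π₂' = block h (π₁ * π₁') (π₂ * π₂') := by
  refine Equiv.ext fun x => ?_
  obtain ⟨y, rfl⟩ := (split i n h).surjective x
  rcases y with a | a <;> simp [block_inl, block_inr]

lemma block_one {i n : ℕ} (h : i ≤ n) : block h 1 1 = 1 := by
  refine Equiv.ext fun x => ?_
  obtain ⟨y, rfl⟩ := (split i n h).surjective x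
  rcases y with a | a <;> simp [block_inl, block_inr]

lemma perm_eq_one_of_lt {i : ℕ} (f g : Fin i → Fin n) (π : Equiv.Perm (Fin i))
    (hf : ∀ a b, a < b → f a < f b) (hg : ∀ a b, a < b → g a < g b)
    (hfg : ∀ a, g a = f (π a)) : π = 1 := by
  have h1 : StrictMono f := fun a b => hf a b
  have h2 : StrictMono g := fun a b => hg a b
  have : StrictMono π := fun a b hab => by
    have := h2 hab
    rw [hfg, hfg] at this
    exact h1.lt_iff_lt.mp this
  refine Equiv.ext fun a => ?_
  have e := Subsingleton.elim (this.orderIsoOfSurjective π π.surjective) (OrderIso.refl (Fin i))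
  exact congrArg (fun q : Fin i ≃o Fin i => q a) e

lemma unshuffle_unique {i n : ℕ} (h : i ≤ n) {σ : Equiv.Perm (Fin n)} (π₁ π₂)
    (h1 : σ ∈ unshuffles i n h) (h2 : σ * block h π₁ π₂ ∈ unshuffles i n h) :
    σ * block h π₁ π₂ = σ := by
  simp only [unshuffles, Finset.mem_filter, Finset.mem_univ, true_and, Equiv.Perm.mul_apply,
    block_inl, block_inr] at h1 h2
  have e1 : π₁ = 1 := perm_eq_one_of_lt (fun a => σ (split i n h (Sum.inl a))) _ π₁ h1.1 h2.1
    fun a => rfl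
  have e2 : π₂ = 1 := perm_eq_one_of_lt (fun a => σ (split i n h (Sum.inr a))) _ π₂ h1.2 h2.2
    fun a => rfl
  rw [e1, e2, block_one, mul_one]

/-- A sum over unshuffles of a function that is invariant under block permutations does not change
under left translation. -/
lemma sum_unshuffles_mul {M : Type*} [AddCommMonoid M] {i n : ℕ} (h : i ≤ n)
    (F : Equiv.Perm (Fin n) → M) (hF : ∀ ρ π₁ π₂, F (ρ * block h π₁ π₂) = F ρ)
    (τ : Equiv.Perm (Fin n)) :
    ∑ σ ∈ unshuffles i n h, F (τ * σ) = ∑ σ ∈ unshuffles i n h, F σ := by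
  choose p q hpq using exists_unshuffle h
  have key : ∀ τ : Equiv.Perm (Fin n), ∀ σ ∈ unshuffles i n h,
      τ⁻¹ * (τ * σ * block h (p (τ * σ)) (q (τ * σ))) *
        block h (p (τ⁻¹ * (τ * σ * block h (p (τ * σ)) (q (τ * σ)))))
          (q (τ⁻¹ * (τ * σ * block h (p (τ * σ)) (q (τ * σ))))) = σ := by
    intro τ σ hσ
    have hm := hpq (τ⁻¹ * (τ * σ * block h (p (τ * σ)) (q (τ * σ))))
    revert hm
    generalize p (τ⁻¹ * (τ * σ * block h (p (τ * σ)) (q (τ * σ)))) = a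
    generalize q (τ⁻¹ * (τ * σ * block h (p (τ * σ)) (q (τ * σ)))) = b
    have e : τ⁻¹ * (τ * σ * block h (p (τ * σ)) (q (τ * σ))) * block h a b
        = σ * block h (p (τ * σ) * a) (q (τ * σ) * b) := by
      rw [← block_mul]; group
    rw [e]
    exact unshuffle_unique h _ _ hσ
  refine Finset.sum_bij' (fun σ _ => τ * σ * block h (p (τ * σ)) (q (τ * σ)))
    (fun σ _ => τ⁻¹ * σ * block h (p (τ⁻¹ * σ)) (q (τ⁻¹ * σ)))
    (fun σ _ => hpq _) (fun σ _ => hpq _) (fun σ hσ => key τ σ hσ) (fun σ hσ => ?_)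
    (fun σ _ => (hF _ _ _).symm)
  have := key τ⁻¹ σ hσ
  rwa [inv_inv] at this

end signs

/-! ### The coalgebra `ᶜ∧(W)` -/

section coalgebra

variable {K : Type*} [Field K] {W : Type*} [AddCommGroup W] [Module K W]

/-- The graded-symmetric relations in the `n`-th tensor power:
`w₁ ⊗ ⋯ ⊗ wₙ - ε(σ) w_{σ 1} ⊗ ⋯ ⊗ w_{σ n}` for homogeneous `w₁, …, wₙ`. -/
def symRel (𝒲 : ℤ → Submodule K W) (n : ℕ) : Submodule K (⨂[K] _ : Fin n, W) :=
  Submodule.span K {x | ∃ (d : Fin n → ℤ) (w : Fin n → W) (σ : Equiv.Perm (Fin n)),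
    (∀ i, w i ∈ 𝒲 (d i)) ∧
    x = PiTensorProduct.tprod K w - koszul σ d • PiTensorProduct.tprod K (w ∘ σ)}

/-- `∧ⁿ W`, the `n`-th homogeneous piece of the free graded commutative algebra on `W`. -/
def ExtPow (𝒲 : ℤ → Submodule K W) (n : ℕ) : Type _ := (⨂[K] _ : Fin n, W) ⧸ symRel 𝒲 n

instance (𝒲 : ℤ → Submodule K W) (n : ℕ) : AddCommGroup (ExtPow 𝒲 n) :=
  inferInstanceAs (AddCommGroup ((⨂[K] _ : Fin n, W) ⧸ symRel 𝒲 n))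

instance (𝒲 : ℤ → Submodule K W) (n : ℕ) : Module K (ExtPow 𝒲 n) :=
  inferInstanceAs (Module K ((⨂[K] _ : Fin n, W) ⧸ symRel 𝒲 n))

/-- The quotient map `W^{⊗n} → ∧ⁿ W`. -/
def ExtPow.mk (𝒲 : ℤ → Submodule K W) (n : ℕ) : (⨂[K] _ : Fin n, W) →ₗ[K] ExtPow 𝒲 n :=
  (symRel 𝒲 n).mkQ

/-- The underlying space `⨁_{n ≥ 1} ∧ⁿ W` of the (non-counital) coalgebra `ᶜ∧(W)`. -/
def CExt (𝒲 : ℤ → Submodule K W) : Type _ := ⨁ n : ℕ+, ExtPow 𝒲 n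

instance (𝒲 : ℤ → Submodule K W) : AddCommGroup (CExt 𝒲) :=
  inferInstanceAs (AddCommGroup (⨁ n : ℕ+, ExtPow 𝒲 n))

instance (𝒲 : ℤ → Submodule K W) : Module K (CExt 𝒲) :=
  inferInstanceAs (Module K (⨁ n : ℕ+, ExtPow 𝒲 n))

/-- The inclusion `∧ⁿ W → ᶜ∧(W)`. -/
def CExt.incl (𝒲 : ℤ → Submodule K W) (n : ℕ+) : ExtPow 𝒲 n →ₗ[K] CExt 𝒲 :=
  DirectSum.lof K ℕ+ (fun m : ℕ+ => ExtPow 𝒲 m) n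

/-- The projection `ᶜ∧(W) → ∧ⁿ W`. -/
def CExt.component (𝒲 : ℤ → Submodule K W) (n : ℕ+) : CExt 𝒲 →ₗ[K] ExtPow 𝒲 n :=
  DirectSum.component K ℕ+ (fun m : ℕ+ => ExtPow 𝒲 m) n

/-- The linear map on `ᶜ∧(W)` with given restrictions to the summands `∧ⁿ W`. -/
def CExt.lift (𝒲 : ℤ → Submodule K W) {N : Type*} [AddCommGroup N] [Module K N]
    (f : ∀ n : ℕ+, ExtPow 𝒲 n →ₗ[K] N) : CExt 𝒲 →ₗ[K] N :=
  DirectSum.toModule K ℕ+ N f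

lemma CExt.lift_incl (𝒲 : ℤ → Submodule K W) {N : Type*} [AddCommGroup N] [Module K N]
    (f : ∀ n : ℕ+, ExtPow 𝒲 n →ₗ[K] N) (n : ℕ+) (x : ExtPow 𝒲 n) :
    CExt.lift 𝒲 f (CExt.incl 𝒲 n x) = f n x := by
  have h := DirectSum.toModule_lof K (M := fun m : ℕ+ => ExtPow 𝒲 m) (φ := f) n x
  exact h

/-- `w₁ ∧ ⋯ ∧ wₙ` as a multilinear function with values in `ᶜ∧(W)`. -/
def wedge (𝒲 : ℤ → Submodule K W) (n : ℕ+) :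
    MultilinearMap K (fun _ : Fin n => W) (CExt 𝒲) :=
  (CExt.incl 𝒲 n ∘ₗ ExtPow.mk 𝒲 n).compMultilinearMap
    (PiTensorProduct.tprod K)

lemma wedge_perm (𝒲 : ℤ → Submodule K W) (n : ℕ+) (d : Fin n → ℤ) (w : Fin n → W)
    (hw : ∀ i, w i ∈ 𝒲 (d i)) (σ : Equiv.Perm (Fin n)) :
    wedge 𝒲 n w = koszul σ d • wedge 𝒲 n (w ∘ σ) := by
  have h : ExtPow.mk 𝒲 n (PiTensorProduct.tprod K w)
      = ExtPow.mk 𝒲 n (koszul σ d • PiTensorProduct.tprod K (w ∘ σ)) := by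
    rw [← sub_eq_zero, ← map_sub]
    exact (Submodule.Quotient.mk_eq_zero _).mpr (Submodule.subset_span ⟨d, w, σ, hw, rfl⟩)
  simp only [wedge, LinearMap.compMultilinearMap_apply, LinearMap.comp_apply]
  rw [h, Units.smul_def, map_zsmul, map_zsmul, Units.smul_def]

/-- The part of `ᶜ∧(W)` of degree `p`, where `|w₁ ∧ ⋯ ∧ wₙ| = |w₁| + ⋯ + |wₙ|`. -/
def extDeg (𝒲 : ℤ → Submodule K W) (p : ℤ) : Submodule K (CExt 𝒲) :=
  Submodule.span K {x | ∃ (n : ℕ+) (d : Fin n → ℤ) (w : Fin n → W),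
    (∀ i, w i ∈ 𝒲 (d i)) ∧ ∑ i, d i = p ∧ x = wedge 𝒲 n w}

/-- The linear projection `ᶜ∧(W) → ∧¹ W = W`. -/
def proj (𝒲 : ℤ → Submodule K W) : CExt 𝒲 →ₗ[K] W :=
  (show ExtPow 𝒲 (1 : ℕ+) →ₗ[K] W from Submodule.liftQ (symRel 𝒲 (1 : ℕ+))
    (PiTensorProduct.lift (MultilinearMap.ofSubsingleton K W W (0 : Fin 1) LinearMap.id)) (by
      refine Submodule.span_le.mpr ?_
      rintro _ ⟨d, w, σ, -, rfl⟩
      have : σ = 1 := @Subsingleton.elim (Equiv.Perm (Fin 1)) _ _ _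
      subst this
      have e : koszul (1 : Equiv.Perm (Fin (1 : ℕ+))) d = 1 := koszul_one d
      rw [SetLike.mem_coe, LinearMap.mem_ker, e, one_smul]
      exact (congrArg _ (sub_self _)).trans (map_zero _))) ∘ₗ
  CExt.component 𝒲 1

lemma proj_wedge_one (𝒲 : ℤ → Submodule K W) (w : Fin (1 : ℕ+) → W) :
    proj 𝒲 (wedge 𝒲 1 w) = w (0 : Fin 1) := by
  have h : CExt.component 𝒲 1 (wedge 𝒲 1 w) = ExtPow.mk 𝒲 _ (PiTensorProduct.tprod K w) :=
    DirectSum.component.lof_self K (M := fun m : ℕ+ => ExtPow 𝒲 m) 1 _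
  rw [proj, LinearMap.comp_apply, h]
  exact PiTensorProduct.lift.tprod _

lemma proj_wedge_of_ne (𝒲 : ℤ → Submodule K W) (n : ℕ+) (hn : n ≠ 1) (w : Fin n → W) :
    proj 𝒲 (wedge 𝒲 n w) = 0 := by
  have h : CExt.component 𝒲 1 (wedge 𝒲 n w) = 0 :=
    (DirectSum.component.of K (M := fun m : ℕ+ => ExtPow 𝒲 m) 1 n _).trans (dif_neg hn)
  rw [proj, LinearMap.comp_apply, h, map_zero]

variable {N : Type*} [AddCommGroup N] [Module K N]

/-- The multilinear map on `W` which agrees with `φ d` on homogeneous elements of degrees `d`. -/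
def homExt (𝒲 : ℤ → Submodule K W) [DirectSum.Decomposition 𝒲] {n : ℕ}
    (φ : (Fin n → ℤ) → MultilinearMap K (fun _ : Fin n => W) N) :
    MultilinearMap K (fun _ : Fin n => W) N :=
  (MultilinearMap.fromDirectSumEquiv (R := K) (κ := fun _ : Fin n => ℤ) (M := fun _ p => 𝒲 p)
    (fun d => (φ d).compLinearMap fun i => (𝒲 (d i)).subtype)).compLinearMap
    fun _ => (DirectSum.decomposeLinearEquiv 𝒲).toLinearMap

lemma homExt_apply (𝒲 : ℤ → Submodule K W) [DirectSum.Decomposition 𝒲] {n : ℕ}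
    (φ : (Fin n → ℤ) → MultilinearMap K (fun _ : Fin n => W) N) (d : Fin n → ℤ) (w : Fin n → W)
    (hw : ∀ i, w i ∈ 𝒲 (d i)) : homExt 𝒲 φ w = φ d w := by
  have : (fun i => DirectSum.decompose 𝒲 (w i))
      = fun i => DirectSum.lof K ℤ (fun p => 𝒲 p) (d i) ⟨w i, hw i⟩ := by
    funext i
    exact DirectSum.decompose_of_mem 𝒲 (hw i)
  simp only [homExt, MultilinearMap.compLinearMap_apply, LinearEquiv.coe_coe,
    DirectSum.decomposeLinearEquiv_apply]
  rw [this, MultilinearMap.fromDirectSumEquiv_lof]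
  rfl

/-- A linear map out of `∧ⁿ W` given by a graded-symmetric family of multilinear maps. -/
def extLift (𝒲 : ℤ → Submodule K W) [DirectSum.Decomposition 𝒲] (n : ℕ)
    (φ : (Fin n → ℤ) → MultilinearMap K (fun _ : Fin n => W) N)
    (hφ : ∀ d w σ, (∀ i, w i ∈ 𝒲 (d i)) → φ d w = koszul σ d • φ (d ∘ σ) (w ∘ σ)) :
    ExtPow 𝒲 n →ₗ[K] N :=
  show (⨂[K] _ : Fin n, W) ⧸ symRel 𝒲 n →ₗ[K] N from
  Submodule.liftQ (symRel 𝒲 n) (PiTensorProduct.lift (homExt 𝒲 φ)) (by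
    refine Submodule.span_le.mpr ?_
    rintro _ ⟨d, w, σ, hw, rfl⟩
    rw [SetLike.mem_coe, LinearMap.mem_ker, map_sub, Units.smul_def, map_zsmul,
      PiTensorProduct.lift.tprod, PiTensorProduct.lift.tprod, homExt_apply 𝒲 φ d w hw,
      homExt_apply 𝒲 φ (d ∘ σ) (w ∘ σ) (fun i => hw (σ i)), hφ d w σ hw, Units.smul_def, sub_self])

lemma extLift_mk (𝒲 : ℤ → Submodule K W) [DirectSum.Decomposition 𝒲] (n : ℕ)
    (φ : (Fin n → ℤ) → MultilinearMap K (fun _ : Fin n => W) N) (hφ) (d : Fin n → ℤ)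
    (w : Fin n → W) (hw : ∀ i, w i ∈ 𝒲 (d i)) :
    extLift 𝒲 n φ hφ (ExtPow.mk 𝒲 n (PiTensorProduct.tprod K w)) = φ d w := by
  have h := homExt_apply 𝒲 φ d w hw
  rw [← PiTensorProduct.lift.tprod] at h
  exact h

/-- `(w₁, …, wₙ) ↦ (w_{σ 1} ∧ ⋯ ∧ w_{σ i}) ⊗ (w_{σ (i+1)} ∧ ⋯ ∧ w_{σ n})` for `0 < i < n`. -/
def wedgeTensor (𝒲 : ℤ → Submodule K W) (n i : ℕ) (hi : 0 < i) (hin : i < n)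
    (σ : Equiv.Perm (Fin n)) :
    MultilinearMap K (fun _ : Fin n => W) (CExt 𝒲 ⊗[K] CExt 𝒲) :=
  (MultilinearMap.domCoprod (wedge 𝒲 ⟨i, hi⟩)
    (wedge 𝒲 ⟨n - i, Nat.sub_pos_of_lt hin⟩)).domDomCongr ((split i n hin.le).trans σ)

lemma wedgeTensor_apply (𝒲 : ℤ → Submodule K W) (n i : ℕ) (hi : 0 < i) (hin : i < n)
    (σ : Equiv.Perm (Fin n)) (w : Fin n → W) :
    wedgeTensor 𝒲 n i hi hin σ w =
      wedge 𝒲 ⟨i, hi⟩ (fun a => w (σ (split i n hin.le (Sum.inl a)))) ⊗ₜ[K]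
        wedge 𝒲 ⟨n - i, Nat.sub_pos_of_lt hin⟩
          (fun b => w (σ (split i n hin.le (Sum.inr b)))) := rfl

/-- For degrees `d`, the multilinear map
`(w₁, …, wₙ) ↦ ∑_{0 < i < n} ∑_σ ε(σ) (w_{σ 1} ∧ ⋯ ∧ w_{σ i}) ⊗ (w_{σ (i+1)} ∧ ⋯ ∧ w_{σ n})`
where `σ` runs through the `(i, n-i)`-unshuffles (below, `i` is written as `i + 1`). -/
def comulFamily (𝒲 : ℤ → Submodule K W) (n : ℕ) (d : Fin n → ℤ) :
    MultilinearMap K (fun _ : Fin n => W) (CExt 𝒲 ⊗[K] CExt 𝒲) :=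
  ∑ i : Fin (n - 1), ∑ σ ∈ unshuffles (i + 1) n (by omega),
    koszul σ d • wedgeTensor 𝒲 n (i + 1) (by omega) (by omega) σ

lemma wedgeTensor_block (𝒲 : ℤ → Submodule K W) (n i : ℕ) (hi : 0 < i) (hin : i < n)
    (ρ : Equiv.Perm (Fin n)) (π₁ : Equiv.Perm (Fin i)) (π₂ : Equiv.Perm (Fin (n - i)))
    (d : Fin n → ℤ) (w : Fin n → W) (hw : ∀ i, w i ∈ 𝒲 (d i)) :
    koszul (ρ * block hin.le π₁ π₂) d • wedgeTensor 𝒲 n i hi hin (ρ * block hin.le π₁ π₂) w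
      = koszul ρ d • wedgeTensor 𝒲 n i hi hin ρ w := by
  have h1 := wedge_perm 𝒲 ⟨i, hi⟩ (fun a => d (ρ (split i n hin.le (Sum.inl a))))
    (fun a => w (ρ (split i n hin.le (Sum.inl a)))) (fun a => hw _) π₁
  have h2 := wedge_perm 𝒲 ⟨n - i, Nat.sub_pos_of_lt hin⟩
    (fun a => d (ρ (split i n hin.le (Sum.inr a))))
    (fun a => w (ρ (split i n hin.le (Sum.inr a)))) (fun a => hw _) π₂
  have e1 : (fun a : Fin i => w ((ρ * block hin.le π₁ π₂) (split i n hin.le (Sum.inl a))))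
      = (fun a => w (ρ (split i n hin.le (Sum.inl a)))) ∘ π₁ := by
    funext a
    simp only [Equiv.Perm.mul_apply, block_inl, Function.comp_apply]
  have e2 : (fun a : Fin (n - i) => w ((ρ * block hin.le π₁ π₂) (split i n hin.le (Sum.inr a))))
      = (fun a => w (ρ (split i n hin.le (Sum.inr a)))) ∘ π₂ := by
    funext a
    simp only [Equiv.Perm.mul_apply, block_inr, Function.comp_apply]
  have e1' := congrArg (wedge 𝒲 ⟨i, hi⟩) e1
  have e2' := congrArg (wedge 𝒲 ⟨n - i, Nat.sub_pos_of_lt hin⟩) e2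
  rw [wedgeTensor_apply, wedgeTensor_apply, koszul_mul, koszul_block, h1, h2]
  refine (congrArg₂ (fun x y => (koszul ρ d * (koszul π₁ _ * koszul π₂ _)) • (x ⊗ₜ[K] y))
    e1' e2').trans ?_
  simp only [Units.smul_def, ← Int.cast_smul_eq_zsmul K, TensorProduct.smul_tmul',
    TensorProduct.tmul_smul, smul_smul]
  push_cast
  congr 2
  exact congrArg _ (mul_comm _ _)

lemma comulFamily_perm (𝒲 : ℤ → Submodule K W) (n : ℕ) (d : Fin n → ℤ) (w : Fin n → W)
    (τ : Equiv.Perm (Fin n)) (hw : ∀ i, w i ∈ 𝒲 (d i)) :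
    comulFamily 𝒲 n d w = koszul τ d • comulFamily 𝒲 n (d ∘ τ) (w ∘ τ) := by
  simp only [comulFamily, sum_apply, Finset.smul_sum]
  refine Finset.sum_congr rfl fun i _ => ?_
  have hin : (i : ℕ) + 1 < n := by omega
  rw [← sum_unshuffles_mul hin.le
    (fun σ => (koszul σ d • wedgeTensor 𝒲 n (i + 1) (Nat.succ_pos _) hin σ) w)
    (fun ρ π₁ π₂ => wedgeTensor_block 𝒲 n (i + 1) (Nat.succ_pos _) hin ρ π₁ π₂ d w hw) τ]
  refine Finset.sum_congr rfl fun σ _ => ?_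
  rw [koszul_mul, mul_smul]
  rfl

/-- The comultiplication `Δ : ᶜ∧(W) → ᶜ∧(W) ⊗ ᶜ∧(W)`. -/
def comul (𝒲 : ℤ → Submodule K W) [DirectSum.Decomposition 𝒲] :
    CExt 𝒲 →ₗ[K] CExt 𝒲 ⊗[K] CExt 𝒲 :=
  CExt.lift 𝒲 fun n =>
    extLift 𝒲 n (comulFamily 𝒲 n) fun d w σ hw => comulFamily_perm 𝒲 n d w σ hw

/-- The defining formula of the comultiplication. -/
theorem comul_wedge (𝒲 : ℤ → Submodule K W) [DirectSum.Decomposition 𝒲] (n : ℕ+)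
    (d : Fin n → ℤ) (w : Fin n → W) (hw : ∀ i, w i ∈ 𝒲 (d i)) :
    comul 𝒲 (wedge 𝒲 n w) =
      ∑ i : Fin ((n : ℕ) - 1), ∑ σ ∈ unshuffles (i + 1) n (by omega), koszul σ d •
        (wedge 𝒲 ⟨i + 1, by omega⟩ (fun a => w (σ (split (i + 1) n (by omega) (Sum.inl a)))) ⊗ₜ[K]
          wedge 𝒲 ⟨n - (i + 1), by omega⟩
            (fun b => w (σ (split (i + 1) n (by omega) (Sum.inr b))))) := by
  simp only [comul, wedge, LinearMap.compMultilinearMap_apply, LinearMap.comp_apply,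
    CExt.lift_incl]
  rw [extLift_mk 𝒲 n _ _ d w hw]
  simp only [comulFamily, sum_apply]
  rfl

/-- The linear operator on `ᶜ∧(W)` multiplying elements of degree `p` by `(-1)^{k p}`. -/
def koszulOp (𝒲 : ℤ → Submodule K W) [DirectSum.Decomposition 𝒲] (k : ℤ) :
    CExt 𝒲 →ₗ[K] CExt 𝒲 :=
  CExt.lift 𝒲 fun n =>
    extLift 𝒲 n (fun d => (k * ∑ i, d i).negOnePow • wedge 𝒲 n) fun d w σ hw => by
      simp only [smul_apply, Function.comp_apply, Equiv.sum_comp σ d]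
      rw [wedge_perm 𝒲 n d w hw σ, smul_comm]

theorem koszulOp_of_mem (𝒲 : ℤ → Submodule K W) [DirectSum.Decomposition 𝒲] (k p : ℤ)
    (c : CExt 𝒲) (hc : c ∈ extDeg 𝒲 p) : koszulOp 𝒲 k c = (k * p).negOnePow • c := by
  have : extDeg 𝒲 p ≤ LinearMap.eqLocus (koszulOp 𝒲 k)
      (((k * p).negOnePow : ℤ) • (LinearMap.id : CExt 𝒲 →ₗ[K] CExt 𝒲)) := by
    refine Submodule.span_le.mpr ?_
    rintro _ ⟨n, d, w, hw, rfl, rfl⟩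
    simp only [SetLike.mem_coe, LinearMap.mem_eqLocus, LinearMap.smul_apply, LinearMap.id_apply]
    conv_lhs => simp only [koszulOp, wedge, LinearMap.compMultilinearMap_apply,
      LinearMap.comp_apply, CExt.lift_incl]
    rw [extLift_mk 𝒲 n _ _ d w hw]
    rfl
  exact this hc

/-- A degree `k` coderivation of `ᶜ∧(W)`: a degree `k` linear map `θ` with
`Δ θ = (θ ⊗ id) Δ + (id ⊗ θ) Δ`, where by the Koszul sign convention
`(id ⊗ θ)(a ⊗ b) = (-1)^{k |a|} a ⊗ θ b`. -/
structure IsCoderivation (𝒲 : ℤ → Submodule K W) [DirectSum.Decomposition 𝒲] (k : ℤ)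
    (θ : CExt 𝒲 →ₗ[K] CExt 𝒲) : Prop where
  degree : ∀ p, ∀ c ∈ extDeg 𝒲 p, θ c ∈ extDeg 𝒲 (p + k)
  leibniz : ∀ c, comul 𝒲 (θ c) =
    TensorProduct.map θ LinearMap.id (comul 𝒲 c) +
      TensorProduct.map (koszulOp 𝒲 k) θ (comul 𝒲 c)

/-- The set of differentials on `ᶜ∧(W)`: degree `1` coderivations of square zero. -/
def CoDiff (𝒲 : ℤ → Submodule K W) [DirectSum.Decomposition 𝒲] :
    Set (CExt 𝒲 →ₗ[K] CExt 𝒲) :=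
  {θ | IsCoderivation 𝒲 1 θ ∧ θ ∘ₗ θ = 0}

/-- The `n`-th corestriction of `θ`, as a multilinear function of `w₁, …, wₙ`: the component in
`∧¹ W = W` of `θ (w₁ ∧ ⋯ ∧ wₙ)`. -/
def corestriction (𝒲 : ℤ → Submodule K W) (θ : CExt 𝒲 →ₗ[K] CExt 𝒲) (n : ℕ+) :
    MultilinearMap K (fun _ : Fin n => W) W :=
  (proj 𝒲 ∘ₗ θ).compMultilinearMap (wedge 𝒲 n)

end coalgebra

/-! ### Desuspension and `L∞`-algebras -/

section linf

variable {K : Type*} [Field K] {V : Type*} [AddCommGroup V] [Module K V]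

/-- The grading of the desuspension: `(↓V)^p = V^{p+1}`. The underlying vector space of `↓V` is that
of `V`, and `↓ : V → ↓V` is the identity map, which has degree `-1` for these gradings. -/
def desusp (𝒱 : ℤ → Submodule K V) : ℤ → Submodule K V := fun p => 𝒱 (p + 1)

instance desuspDecomposition (𝒱 : ℤ → Submodule K V) [DirectSum.Decomposition 𝒱] :
    DirectSum.Decomposition (desusp 𝒱) :=
  DirectSum.IsInternal.chooseDecomposition _ (by
    have h := (DirectSum.isInternal_submodule_iff_iSupIndep_and_iSup_eq_top 𝒱).mp
      (DirectSum.Decomposition.isInternal 𝒱)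
    refine (DirectSum.isInternal_submodule_iff_iSupIndep_and_iSup_eq_top _).mpr ⟨?_, ?_⟩
    · exact h.1.comp (f := fun p : ℤ => p + 1) (add_left_injective 1)
    · rw [← h.2]
      exact (Equiv.addRight (1 : ℤ)).iSup_comp (g := 𝒱))

/-- The sign in `↓^{⊗n} (v₁ ⊗ ⋯ ⊗ vₙ) = ± ↓v₁ ⊗ ⋯ ⊗ ↓vₙ` for `vᵢ` of degree `dᵢ`: by the Koszul
sign convention, `vᵢ` is passed by the `n - i` degree `-1` maps `↓` to the right of the `i`-th one,
so the sign is `∏ᵢ (-1)^{(n-i) dᵢ}` for `i = 1, …, n` (below, `i` is written as `i + 1`). -/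
def desuspSign {n : ℕ} (d : Fin n → ℤ) : ℤˣ :=
  ∏ i : Fin n, (((n : ℤ) - ((i : ℤ) + 1)) * d i).negOnePow

/-- An `L∞`-algebra structure on the graded vector space `V`: the linear maps `l k : V^{⊗k} → V`,
`k ≥ 1`, are given as multilinear maps. In the axiom `(L_n)` the number `i` of the inputs
of the inner operation is written as `i + 1`, so that `j = n - i`, i.e. `j = (n - (i + 1)) + 1`. -/
@[ext]
structure LInfStructure (𝒱 : ℤ → Submodule K V) where
  l : ∀ k : ℕ+, MultilinearMap K (fun _ : Fin k => V) V
  degree : ∀ (k : ℕ+) (d : Fin k → ℤ) (v : Fin k → V), (∀ a, v a ∈ 𝒱 (d a)) →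
    l k v ∈ 𝒱 (∑ a, d a + (2 - (k : ℤ)))
  antisymm : ∀ (k : ℕ+) (d : Fin k → ℤ) (v : Fin k → V), (∀ a, v a ∈ 𝒱 (d a)) →
    ∀ σ : Equiv.Perm (Fin k), l k (v ∘ σ) = antiKoszul σ d • l k v
  jacobi : ∀ (n : ℕ) (_ : 1 ≤ n) (d : Fin n → ℤ) (v : Fin n → V), (∀ a, v a ∈ 𝒱 (d a)) →
    ∑ i : Fin n, (-1 : ℤˣ) ^ ((i : ℕ) + 1) •
      ∑ σ ∈ unshuffles (i + 1) n i.2, antiKoszul σ d •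
        l (Nat.succPNat (n - (i + 1)))
          (Fin.cons (α := fun _ => V)
            (l (Nat.succPNat i) fun a => v (σ (split (i + 1) n i.2 (Sum.inl a))))
            fun b => v (σ (split (i + 1) n i.2 (Sum.inr b)))) = 0

end linf

end LInfty

end

noncomputable section

open scoped TensorProduct DirectSum

namespace LInfty

/-! ### Signed sums over the splittings of a list -/

section splittings

variable {H : Type*} (δ : H → ℤ) {M : Type*} [AddCommGroup M]

/-! A degree `1` coderivation of `ᶜ∧(W)` is the same thing as its family of corestrictions, which
can be any graded-symmetric family of degree `1` (`IsSymmFamily`). Existence: send a word to the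
signed sum of f(A) ∧ B over all its splittings into subwords A and B (`coderivation`). The Leibniz
rule then follows from coassociativity and cocommutativity of splitting (`coderivation_leibniz`).
Uniqueness: a map with a twisted Leibniz rule and zero component in W vanishes, by induction on word
length (`eq_zero_of_leibniz`). This rests on the injectivity of Δ on the kernel of the projection to
W (`eq_zero_of_comul_eq_zero`): splitting off one letter and multiplying it back is multiplication
by n on ∧ⁿ for n ≥ 2, and n is invertible in characteristic zero.

The square of an odd coderivation θ again obeys a twisted Leibniz rule, because the cross terms
cancel. Hence θ² = 0 as soon as its component in W vanishes, and that component is a quadratic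
expression in the corestrictions (`coderivation_comp_self_eq_zero_iff`).

What remains is a comparison of signs. The sign of the theorem defines an involution `twist` on
families of multilinear maps. It exchanges χ-antisymmetry for the degrees of V with ε-symmetry for
the degrees of ↓V (`koszul_mul_twistSign`), and it carries the quadratic relation to the Jacobi
identity up to one global sign (`twist_quadratic`).

Unshuffles do not lend themselves to induction, so sums over them are rewritten as `splitSum`, a
recursion on a list in which each letter joins A or B (`sum_unshuffleSum`). The empty word is given
wedge product zero, so that the two trivial splittings may be included in the reduced
comultiplication. -/

/-- The total degree of a list. -/
def listDeg (l : List H) : ℤ := (l.map δ).sum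

@[simp] lemma listDeg_nil : listDeg δ [] = 0 := rfl

@[simp] lemma listDeg_cons (x : H) (l : List H) : listDeg δ (x :: l) = δ x + listDeg δ l := by
  simp [listDeg]

/-- The sum of `G A B` over all splittings of a list into two complementary sublists `A`, `B`, with
the Koszul sign of the permutation that moves `A` in front of `B`. -/
def splitSum : List H → (List H → List H → M) → M
  | [], G => G [] []
  | x :: l, G =>
    splitSum l fun A B => G (x :: A) B + (δ x * listDeg δ A).negOnePow • G A (x :: B)

/-- Only complementary sublists occur, so degrees and lengths may be assumed to add up. The degree
condition feeds the sign computations, the length condition the arguments on word length. -/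
lemma splitSum_congr (l : List H) (F G : List H → List H → M)
    (h : ∀ A B, listDeg δ A + listDeg δ B = listDeg δ l → A.length + B.length = l.length →
      F A B = G A B) : splitSum δ l F = splitSum δ l G := by
  induction l generalizing F G with
  | nil => exact h [] [] rfl rfl
  | cons x l ih =>
    refine ih _ _ fun A B h1 h2 => ?_
    rw [h (x :: A) B (by simp [add_assoc, h1]) (by simp; omega),
      h A (x :: B) (by simp; omega) (by simp; omega)]

lemma splitSum_add (l : List H) (F G : List H → List H → M) :
    splitSum δ l (fun A B => F A B + G A B) = splitSum δ l F + splitSum δ l G := by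
  induction l generalizing F G with
  | nil => rfl
  | cons x l ih =>
    simp only [splitSum, ← ih, smul_add]
    exact splitSum_congr δ l _ _ fun A B _ _ => by abel

lemma splitSum_zero (l : List H) : splitSum δ l (fun _ _ => (0 : M)) = 0 := by
  induction l with
  | nil => rfl
  | cons x l ih => simpa [splitSum] using ih

lemma map_splitSum {M' : Type*} [AddCommGroup M'] (f : M →+ M') (l : List H)
    (F : List H → List H → M) :
    f (splitSum δ l F) = splitSum δ l fun A B => f (F A B) := by
  induction l generalizing F with
  | nil => rfl
  | cons x l ih => simp [splitSum, ih, Units.smul_def, map_zsmul]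

lemma smul_splitSum (s : ℤˣ) (l : List H) (F : List H → List H → M) :
    s • splitSum δ l F = splitSum δ l fun A B => s • F A B :=
  map_splitSum δ (DistribSMul.toAddMonoidHom M s) l F

/-- Coassociativity of splitting. -/
lemma splitSum_assoc (l : List H) (F : List H → List H → List H → M) :
    splitSum δ l (fun A B => splitSum δ B fun C D => F A C D) =
      splitSum δ l fun E D => splitSum δ E fun A C => F A C D := by
  induction l generalizing F with
  | nil => rfl
  | cons x l ih =>
    simp only [splitSum]
    rw [splitSum_add, splitSum_add]
    simp only [smul_splitSum]
    rw [ih, ih, ← splitSum_add, ← splitSum_add]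
    refine splitSum_congr δ l _ _ fun E D _ _ => ?_
    rw [← splitSum_add, ← splitSum_add]
    refine splitSum_congr δ E _ _ fun A C h _ => ?_
    -- A letter that joins the last part passes A and then C on one side, and the whole of E on the
    -- other.
    rw [smul_add, smul_smul, ← h, mul_add, Int.negOnePow_add, add_assoc]

/-- Graded cocommutativity of splitting. -/
lemma splitSum_comm (l : List H) (F : List H → List H → M) :
    splitSum δ l F =
      splitSum δ l fun A B => (listDeg δ A * listDeg δ B).negOnePow • F B A := by
  induction l generalizing F with
  | nil => simp [splitSum]
  | cons x l ih =>
    simp only [splitSum]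
    rw [ih]
    refine splitSum_congr δ l _ _ fun A B _ _ => ?_
    rw [smul_add, add_comm, smul_smul, smul_smul, ← Int.negOnePow_add, ← Int.negOnePow_add]
    congr 2
    · rw [listDeg_cons]
      congr 1
      ring
    · rw [listDeg_cons, Int.negOnePow_eq_iff]
      -- The sign of `x` passing A occurs twice here and cancels.
      exact ⟨-(listDeg δ A * δ x), by ring⟩

lemma splitSum_of_left_ne_nil (l : List H) (F : List H → List H → M)
    (h : ∀ A B, A ≠ [] → F A B = 0) : splitSum δ l F = F [] l := by
  induction l generalizing F with
  | nil => rfl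
  | cons x l ih =>
    rw [splitSum, ih]
    · simp [h (x :: []) l (by simp)]
    · intro A B hA
      simp [h (x :: A) B (by simp), h A (x :: B) hA]

end splittings

/-! ### Sums over unshuffles as sums over splittings -/

section bridge

/-- Two positions `a < b` lie in the same block exactly when `b` is in the first one or `a` is in
the second. This form avoids `split` and leaves only inequalities between positions. -/
lemma mem_unshuffles_iff {i n : ℕ} (h : i ≤ n) (σ : Equiv.Perm (Fin n)) :
    σ ∈ unshuffles i n h ↔
      ∀ a b : Fin n, a < b → (b.val < i ∨ i ≤ a.val) → σ a < σ b := by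
  simp only [unshuffles, Finset.mem_filter, Finset.mem_univ, true_and]
  constructor
  · rintro ⟨h1, h2⟩ a b hab (hb | ha)
    · have e : ∀ c : Fin n, ∀ hc : c.val < i, split i n h (Sum.inl ⟨c, hc⟩) = c :=
        fun c hc => Fin.ext (split_inl_val h _)
      have := h1 ⟨a, by omega⟩ ⟨b, hb⟩ hab
      rwa [e, e] at this
    · have e : ∀ c : Fin n, ∀ hc : i ≤ c.val,
          split i n h (Sum.inr ⟨c - i, Nat.sub_lt_sub_right hc c.2⟩) = c :=
        fun c hc => Fin.ext ((split_inr_val h _).trans (Nat.add_sub_cancel' hc))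
      have hb : i ≤ b.val := ha.trans hab.le
      have := h2 ⟨a - i, by omega⟩ ⟨b - i, by omega⟩ (Nat.sub_lt_sub_right ha hab)
      rwa [e a ha, e b hb] at this
  · intro H
    refine ⟨fun a b hab => H _ _ ?_ ?_, fun a b hab => H _ _ ?_ ?_⟩
    · rwa [Fin.lt_def, split_inl_val, split_inl_val]
    · simp [split_inl_val]
    · rwa [Fin.lt_def, split_inr_val, split_inr_val, add_lt_add_iff_left]
    · simp [split_inr_val]

/-- The permutation of `Fin (n + 1)` that fixes `0` and acts by `π` on the successors. -/
def consPerm {n : ℕ} (π : Equiv.Perm (Fin n)) : Equiv.Perm (Fin (n + 1)) :=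
  Equiv.Perm.decomposeFin.symm (0, π)

@[simp] lemma consPerm_zero {n : ℕ} (π : Equiv.Perm (Fin n)) : consPerm π 0 = 0 := by
  simp [consPerm]

@[simp] lemma consPerm_succ {n : ℕ} (π : Equiv.Perm (Fin n)) (a : Fin n) :
    consPerm π a.succ = (π a).succ := by
  simp [consPerm]

lemma consPerm_injective {n : ℕ} : Function.Injective (consPerm (n := n)) := fun π π' h => by
  have := Equiv.Perm.decomposeFin.symm.injective h
  exact (Prod.ext_iff.mp this).2

lemma exists_consPerm {n : ℕ} (σ : Equiv.Perm (Fin (n + 1))) (h : σ 0 = 0) :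
    ∃ π, consPerm π = σ := by
  obtain ⟨⟨p, π⟩, rfl⟩ := Equiv.Perm.decomposeFin.symm.surjective σ
  rw [Equiv.Perm.decomposeFin_symm_apply_zero] at h
  subst h
  exact ⟨π, rfl⟩

lemma cons_comp_consPerm {n : ℕ} {α : Type*} (x : α) (u : Fin n → α) (π : Equiv.Perm (Fin n)) :
    (Fin.cons x u : Fin (n + 1) → α) ∘ consPerm π = Fin.cons x (u ∘ π) := by
  funext a
  refine Fin.cases ?_ (fun a => ?_) a <;> simp

lemma koszul_consPerm {n : ℕ} (π : Equiv.Perm (Fin n)) (x : ℤ) (u : Fin n → ℤ) :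
    koszul (consPerm π) (Fin.cons x u) = koszul π u := by
  simp [koszul, Fin.prod_univ_succ]

lemma negOnePow_sum {ι : Type*} (s : Finset ι) (f : ι → ℤ) :
    (∑ i ∈ s, f i).negOnePow = ∏ i ∈ s, (f i).negOnePow := by
  classical
  induction s using Finset.induction_on with
  | empty => simp
  | insert a s ha ih => rw [Finset.sum_insert ha, Finset.prod_insert ha, Int.negOnePow_add, ih]

/-- The cycle takes the first element to position `p` and keeps the order of the others. Its
inversions are therefore the pairs `(a, p)` with `a < p`, that is, the first `p` entries of `u`
passed by `x`. -/
lemma koszul_cycleRange {n : ℕ} (p : Fin (n + 1)) (x : ℤ) (u : Fin n → ℤ) :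
    koszul p.cycleRange (Fin.cons x u) =
      (x * ((List.ofFn u).take p).sum).negOnePow := by
  have h : ∀ b : Fin n, (∏ a, if a < p.succAbove b ∧
      p.cycleRange (p.succAbove b) < p.cycleRange a then
        ((Fin.cons x u : Fin (n + 1) → ℤ) (p.cycleRange a) *
          (Fin.cons x u : Fin (n + 1) → ℤ) (p.cycleRange (p.succAbove b))).negOnePow else 1) = 1 := by
    intro b
    refine Finset.prod_eq_one fun a _ => if_neg ?_
    rintro ⟨h1, h2⟩
    rcases Fin.eq_self_or_eq_succAbove p a with rfl | ⟨a, rfl⟩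
    · simp [Fin.cycleRange_self] at h2
    · rw [Fin.cycleRange_succAbove, Fin.cycleRange_succAbove, Fin.succ_lt_succ_iff] at h2
      exact lt_asymm h2 ((Fin.strictMono_succAbove p).lt_iff_lt.mp h1)
  rw [koszul, Finset.prod_comm, Fin.prod_univ_succAbove _ p, Finset.prod_eq_one fun b _ => h b,
    mul_one, Fin.prod_univ_succAbove _ p, List.sum_take_ofFn, Finset.mul_sum, negOnePow_sum,
    Finset.prod_filter]
  simp only [lt_self_iff_false, false_and, if_false, one_mul, Fin.cycleRange_self,
    Fin.cycleRange_succAbove, Fin.cons_zero, Fin.cons_succ, Fin.succ_pos, and_true]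
  refine Finset.prod_congr rfl fun a _ => ?_
  have : p.succAbove a < p ↔ (a : ℕ) < p := by
    rw [Fin.succAbove_lt_iff_castSucc_lt, Fin.lt_def, Fin.val_castSucc]
  simp only [this, mul_comm]

lemma ofFn_insertNth {n : ℕ} {α : Type*} (p : Fin (n + 1)) (x : α) (u : Fin n → α) :
    List.ofFn (p.insertNth x u : Fin (n + 1) → α) =
      (List.ofFn u).take p ++ x :: (List.ofFn u).drop p := by
  induction n with
  | zero =>
    obtain rfl : p = 0 := Fin.fin_one_eq_zero p
    simp
  | succ n ih =>
    refine Fin.cases ?_ (fun p => ?_) p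
    · simp
    · have : (p.succ.insertNth x u : Fin (n + 1 + 1) → α)
          = Fin.cons (u 0) (p.insertNth x (fun a => u a.succ)) := by
        rw [Fin.insertNth_eq_iff]
        constructor
        · simp
        · funext a
          refine Fin.cases ?_ (fun a => ?_) a <;> simp [Fin.removeNth]
      rw [this, List.ofFn_cons, ih, List.ofFn_succ (f := u)]
      simp

variable {H : Type*} (δ : H → ℤ) {M : Type*} [AddCommGroup M]

/-- The term of type `(i, n - i)` in the sum over the splittings of `h`. -/
def unshuffleSum {n : ℕ} (h : Fin n → H) (G : List H → List H → M) (i : ℕ) : M :=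
  if hi : i ≤ n then ∑ σ ∈ unshuffles i n hi, koszul σ (δ ∘ h) •
    G ((List.ofFn (h ∘ σ)).take i) ((List.ofFn (h ∘ σ)).drop i) else 0

/-- Both blocks are increasing, so the smallest value must stand at the head of one of them. This
dichotomy matches the two terms in the recursion of `splitSum`. -/
lemma unshuffle_zero_or {i n : ℕ} (hi : i ≤ n + 1) (σ : Equiv.Perm (Fin (n + 1)))
    (hσ : σ ∈ unshuffles i (n + 1) hi) : (0 < i ∧ σ 0 = 0) ∨ ∃ h : i < n + 1, σ ⟨i, h⟩ = 0 := by
  rw [mem_unshuffles_iff] at hσ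
  obtain ⟨q, hq⟩ := σ.surjective 0
  by_cases h : q.val < i
  · left
    refine ⟨by omega, ?_⟩
    by_contra h0
    have hq0 : 0 < q := by
      rw [Fin.pos_iff_ne_zero]
      rintro rfl
      exact h0 hq
    have := hσ 0 q hq0 (Or.inl h)
    rw [hq] at this
    exact absurd this (Fin.not_lt_zero _)
  · right
    have hi' : i < n + 1 := by omega
    refine ⟨hi', ?_⟩
    by_contra h0
    have hlt : (⟨i, hi'⟩ : Fin (n + 1)) < q := by
      refine lt_of_le_of_ne (by simp [Fin.le_def]; omega) ?_
      rintro rfl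
      exact h0 hq
    have := hσ _ q hlt (Or.inr le_rfl)
    rw [hq] at this
    exact absurd this (Fin.not_lt_zero _)

lemma consPerm_mem_unshuffles {i n : ℕ} (hi : i ≤ n) (π : Equiv.Perm (Fin n)) :
    consPerm π ∈ unshuffles (i + 1) (n + 1) (by omega) ↔ π ∈ unshuffles i n hi := by
  simp only [mem_unshuffles_iff]
  constructor
  · intro H a b hab h
    have := H a.succ b.succ (by simpa using hab) (by simpa using h)
    simpa using this
  · intro H a b
    refine Fin.cases ?_ (fun a => ?_) a <;> refine Fin.cases ?_ (fun b => ?_) b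
    · simp
    · simp
    · simp
    · intro hab h
      have := H a b (by simpa using hab) (by simpa using h)
      simpa using this

lemma consPerm_mul_cycleRange_mem_unshuffles {i n : ℕ} (hi : i ≤ n) (π : Equiv.Perm (Fin n)) :
    consPerm π * (⟨i, by omega⟩ : Fin (n + 1)).cycleRange ∈
      unshuffles i (n + 1) (by omega) ↔ π ∈ unshuffles i n hi := by
  simp only [mem_unshuffles_iff, Equiv.Perm.mul_apply]
  set p : Fin (n + 1) := ⟨i, by omega⟩ with hp
  have hv : ∀ a : Fin n, (p.succAbove a).val = if a.val < i then a.val else a.val + 1 := by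
    intro a
    simp only [Fin.succAbove, Fin.lt_def, hp, Fin.val_castSucc]
    split_ifs <;> simp
  constructor
  · intro H a b hab h
    have := H (p.succAbove a) (p.succAbove b) ((Fin.strictMono_succAbove p) hab) (by
      rw [hv, hv]
      rw [Fin.lt_def] at hab
      split_ifs <;> omega)
    simpa using this
  · intro H a b hab h
    rcases Fin.eq_self_or_eq_succAbove p a with rfl | ⟨a, rfl⟩ <;>
      rcases Fin.eq_self_or_eq_succAbove p b with rfl | ⟨b, rfl⟩
    · exact absurd hab (lt_irrefl _)
    · simp
    · exfalso
      rw [Fin.lt_def] at hab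
      have := hv a
      simp only [hp] at hab h
      omega
    · have := H a b ((Fin.strictMono_succAbove p).lt_iff_lt.mp hab) (by
        have h1 := hv a
        have h2 := hv b
        split_ifs at h1 h2 <;> omega)
      simpa using this

lemma consPerm_mul_cycleRange_apply {i n : ℕ} (hi : i < n + 1) (π : Equiv.Perm (Fin n)) :
    (consPerm π * (⟨i, hi⟩ : Fin (n + 1)).cycleRange) ⟨i, hi⟩ = 0 := by
  simp

/-- The case where `x` heads the first block: such unshuffles are the `consPerm π`, and leaving `x`
in front costs no sign. -/
lemma sum_unshuffles_zero_eq_zero {n i : ℕ} (hi : i ≤ n) (x : H) (g : Fin n → H)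
    (G : List H → List H → M) :
    (∑ σ ∈ (unshuffles (i + 1) (n + 1) (by omega)).filter (fun σ => σ 0 = 0),
      koszul σ (δ ∘ (Fin.cons x g : Fin (n + 1) → H)) •
        G ((List.ofFn ((Fin.cons x g : Fin (n + 1) → H) ∘ σ)).take (i + 1))
          ((List.ofFn ((Fin.cons x g : Fin (n + 1) → H) ∘ σ)).drop (i + 1))) =
      unshuffleSum δ g (fun A B => G (x :: A) B) i := by
  rw [unshuffleSum, dif_pos hi]
  symm
  refine Finset.sum_bij (fun π _ => consPerm π) ?_ ?_ ?_ ?_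
  · intro π hπ
    simpa using (consPerm_mem_unshuffles hi π).mpr hπ
  · intro π _ π' _ h
    exact consPerm_injective h
  · intro σ hσ
    obtain ⟨h1, h2⟩ := Finset.mem_filter.mp hσ
    obtain ⟨π, rfl⟩ := exists_consPerm σ h2
    exact ⟨π, (consPerm_mem_unshuffles hi π).mp h1, rfl⟩
  · intro π _
    have e : (δ ∘ (Fin.cons x g : Fin (n + 1) → H)) = Fin.cons (δ x) (δ ∘ g) := Fin.comp_cons ..
    rw [cons_comp_consPerm, e, koszul_consPerm, List.ofFn_cons]
    simp

/-- The case where `x` heads the second block: such an unshuffle is some `consPerm π` followed, on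
the side of positions, by the cycle that moves `x` to position `i`. The cycle contributes the sign
of `x` passing the first block. -/
lemma sum_unshuffles_apply_eq_zero {n i : ℕ} (hi : i ≤ n) (x : H) (g : Fin n → H)
    (G : List H → List H → M) :
    (∑ σ ∈ (unshuffles i (n + 1) (by omega)).filter (fun σ => σ ⟨i, by omega⟩ = 0),
      koszul σ (δ ∘ (Fin.cons x g : Fin (n + 1) → H)) •
        G ((List.ofFn ((Fin.cons x g : Fin (n + 1) → H) ∘ σ)).take i)
          ((List.ofFn ((Fin.cons x g : Fin (n + 1) → H) ∘ σ)).drop i)) =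
      unshuffleSum δ g (fun A B => (δ x * listDeg δ A).negOnePow • G A (x :: B)) i := by
  rw [unshuffleSum, dif_pos hi]
  symm
  refine Finset.sum_bij (fun π _ => consPerm π * (⟨i, by omega⟩ : Fin (n + 1)).cycleRange)
    ?_ ?_ ?_ ?_
  · intro π hπ
    rw [Finset.mem_filter]
    exact ⟨(consPerm_mul_cycleRange_mem_unshuffles hi π).mpr hπ,
      consPerm_mul_cycleRange_apply (by omega) π⟩
  · intro π _ π' _ h
    exact consPerm_injective (mul_right_cancel h)
  · intro σ hσ
    obtain ⟨h1, h2⟩ := Finset.mem_filter.mp hσ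
    obtain ⟨π, hπ⟩ := exists_consPerm (σ * (⟨i, by omega⟩ : Fin (n + 1)).cycleRange⁻¹) (by
      rw [Equiv.Perm.mul_apply, Equiv.Perm.inv_def, Fin.cycleRange_symm_zero, h2])
    rw [eq_mul_inv_iff_mul_eq] at hπ
    exact ⟨π, (consPerm_mul_cycleRange_mem_unshuffles hi π).mp (hπ ▸ h1), hπ⟩
  · intro π _
    have e : (Fin.cons x g : Fin (n + 1) → H) ∘
        (consPerm π * (⟨i, by omega⟩ : Fin (n + 1)).cycleRange : Equiv.Perm (Fin (n + 1)))
        = (⟨i, by omega⟩ : Fin (n + 1)).insertNth x (g ∘ π) := by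
      rw [Equiv.Perm.coe_mul, ← Function.comp_assoc, cons_comp_consPerm, Fin.cons_comp_cycleRange]
    have e2 : (δ ∘ (Fin.cons x g : Fin (n + 1) → H)) = Fin.cons (δ x) (δ ∘ g) := Fin.comp_cons ..
    have hl : ((List.ofFn (g ∘ π)).take i).length = i := by simp; omega
    rw [e, ofFn_insertNth, koszul_mul, e2, cons_comp_consPerm, koszul_consPerm, koszul_cycleRange,
      mul_smul]
    simp only []
    rw [List.take_left' hl, List.drop_left' hl, Function.comp_assoc, listDeg, List.map_take,
      List.map_ofFn]

lemma unshuffleSum_cons_zero {n : ℕ} (x : H) (g : Fin n → H) (G : List H → List H → M) :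
    unshuffleSum δ (Fin.cons x g : Fin (n + 1) → H) G 0 =
      unshuffleSum δ g (fun A B => (δ x * listDeg δ A).negOnePow • G A (x :: B)) 0 := by
  rw [← sum_unshuffles_apply_eq_zero δ (Nat.zero_le n), unshuffleSum, dif_pos (Nat.zero_le _),
    Finset.filter_true_of_mem]
  intro σ hσ
  rcases unshuffle_zero_or _ σ hσ with h | ⟨_, h⟩
  · exact absurd h.1 (lt_irrefl _)
  · exact h

lemma unshuffleSum_cons_succ {n i : ℕ} (hi : i ≤ n) (x : H) (g : Fin n → H)
    (G : List H → List H → M) :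
    unshuffleSum δ (Fin.cons x g : Fin (n + 1) → H) G (i + 1) =
      unshuffleSum δ g (fun A B => G (x :: A) B) i +
      unshuffleSum δ g (fun A B => (δ x * listDeg δ A).negOnePow • G A (x :: B)) (i + 1) := by
  rw [unshuffleSum, dif_pos (by omega : i + 1 ≤ n + 1),
    ← Finset.sum_filter_add_sum_filter_not _ (fun σ => σ 0 = 0), sum_unshuffles_zero_eq_zero δ hi]
  congr 1
  by_cases h : i + 1 ≤ n
  · rw [← sum_unshuffles_apply_eq_zero δ h]
    refine Finset.sum_congr (Finset.filter_congr fun σ hσ => ?_) fun _ _ => rfl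
    rcases unshuffle_zero_or _ σ hσ with h | ⟨h, h'⟩
    · simp only [h.2, not_true, false_iff]
      intro h'
      have := σ.injective (h'.trans h.2.symm)
      simp at this
    · simp only [h', iff_true]
      intro h0
      have := σ.injective (h'.trans h0.symm)
      simp at this
  -- Here `i = n`: the second block is empty and cannot contain `x`, in agreement with the default
  -- value `0` of `unshuffleSum`.
  · rw [unshuffleSum, dif_neg h, Finset.filter_false_of_mem, Finset.sum_empty]
    intro σ hσ
    rcases unshuffle_zero_or _ σ hσ with h | ⟨h, h'⟩
    · simp [h.2]
    · omega

/-- The sum over all unshuffles is the sum over all splittings. -/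
lemma sum_unshuffleSum {n : ℕ} (h : Fin n → H) (G : List H → List H → M) :
    ∑ i ∈ Finset.range (n + 1), unshuffleSum δ h G i = splitSum δ (List.ofFn h) G := by
  induction n generalizing G with
  | zero =>
    have : unshuffles 0 0 le_rfl = {1} := by
      ext σ
      simp [mem_unshuffles_iff, Subsingleton.elim σ 1]
    simp [unshuffleSum, splitSum, this, koszul_one]
  | succ n ih =>
    obtain ⟨x, g, rfl⟩ : ∃ x g, h = (Fin.cons x g : Fin (n + 1) → H) :=
      ⟨h 0, fun a => h a.succ, (Fin.cons_self_tail h).symm⟩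
    rw [List.ofFn_cons, splitSum, splitSum_add, ← ih, ← ih, Finset.sum_range_succ',
      Finset.sum_congr rfl (fun i hi =>
        unshuffleSum_cons_succ δ (by simpa [Nat.lt_succ_iff] using hi) x g G),
      Finset.sum_add_distrib, unshuffleSum_cons_zero, add_assoc, ← Finset.sum_range_succ',
      Finset.sum_range_succ _ (n + 1)]
    -- The surplus term has index `n + 1 > n` and is zero by default.
    simp [unshuffleSum]

end bridge

/-! ### Splitting sums with a trivial part, and unshuffles with nonempty first block -/

section splittings

variable {H : Type*} (δ : H → ℤ) {M : Type*} [AddCommGroup M]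

lemma splitSum_of_right_ne_nil (l : List H) (F : List H → List H → M)
    (h : ∀ A B, B ≠ [] → F A B = 0) : splitSum δ l F = F l [] := by
  induction l generalizing F with
  | nil => rfl
  | cons x l ih =>
    rw [splitSum, ih]
    · simp [h l [x] (by simp)]
    · intro A B hB
      simp [h (x :: A) B hB, h A (x :: B) (by simp)]

lemma splitSum_mem (S : AddSubgroup M) (l : List H) (F : List H → List H → M)
    (h : ∀ A B, listDeg δ A + listDeg δ B = listDeg δ l → F A B ∈ S) :
    splitSum δ l F ∈ S := by
  induction l generalizing F with
  | nil => exact h [] [] rfl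
  | cons x l ih =>
    refine ih _ fun A B hAB => S.add_mem (h _ _ (by simp [add_assoc, hAB])) ?_
    rw [Units.smul_def]
    exact S.zsmul_mem (h _ _ (by simp; omega)) _

lemma take_ofFn_split {α : Type*} {i n : ℕ} (h : i ≤ n) (w : Fin n → α) :
    (List.ofFn w).take i = List.ofFn fun a => w (split i n h (Sum.inl a)) := by
  refine List.ext_getElem (by simpa using h) fun k h1 h2 => ?_
  simp only [List.getElem_take, List.getElem_ofFn]
  exact congrArg w (Fin.ext (by simp [split_inl_val]))

lemma drop_ofFn_split {α : Type*} {i n : ℕ} (h : i ≤ n) (w : Fin n → α) :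
    (List.ofFn w).drop i = List.ofFn fun a => w (split i n h (Sum.inr a)) := by
  refine List.ext_getElem (by simp) fun k h1 h2 => ?_
  simp only [List.getElem_drop, List.getElem_ofFn]
  exact congrArg w (Fin.ext (by simp [split_inr_val]))

/-- The sum over the unshuffles with nonempty first block. -/
lemma sum_unshuffles_eq_splitSum {n : ℕ} (h : Fin n → H) (G : List H → List H → M)
    (hG : ∀ B, G [] B = 0) :
    ∑ i : Fin n, ∑ σ ∈ unshuffles (i + 1) n i.2, koszul σ (δ ∘ h) •
      G (List.ofFn fun a => h (σ (split (i + 1) n i.2 (Sum.inl a))))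
        (List.ofFn fun b => h (σ (split (i + 1) n i.2 (Sum.inr b)))) =
      splitSum δ (List.ofFn h) G := by
  rw [← sum_unshuffleSum, Finset.sum_range_succ', Finset.sum_range]
  have h0 : unshuffleSum δ h G 0 = 0 := by simp [unshuffleSum, hG]
  rw [h0, add_zero]
  refine Finset.sum_congr rfl fun i _ => ?_
  rw [unshuffleSum, dif_pos (Nat.succ_le_of_lt i.2)]
  refine Finset.sum_congr rfl fun σ _ => ?_
  rw [take_ofFn_split i.2, drop_ofFn_split i.2]
  rfl

end splittings

/-! ### Lists of homogeneous elements -/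

section homogeneous

variable {K : Type*} [Field K] {W : Type*} [AddCommGroup W] [Module K W]
variable {N : Type*} [AddCommGroup N] [Module K N]

/-- The homogeneous elements of a graded vector space, with their degrees. -/
abbrev HomEl (𝒲 : ℤ → Submodule K W) := Σ p : ℤ, 𝒲 p

/-- The total degree of a list of homogeneous elements. -/
abbrev hdeg (𝒲 : ℤ → Submodule K W) (l : List (HomEl 𝒲)) : ℤ := listDeg Sigma.fst l

/-- The value of a family of multilinear maps on a list of homogeneous elements (zero on the empty
list). -/
def evalList (𝒲 : ℤ → Submodule K W) (F : ∀ n : ℕ+, MultilinearMap K (fun _ : Fin n => W) N) :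
    List (HomEl 𝒲) → N
  | [] => 0
  | x :: l => F (Nat.succPNat l.length) fun a : Fin (l.length + 1) => (((x :: l).get a).2 : W)

variable (𝒲 : ℤ → Submodule K W)

lemma evalList_eq (F : ∀ n : ℕ+, MultilinearMap K (fun _ : Fin n => W) N) (l : List (HomEl 𝒲))
    (n : ℕ+) (hn : (n : ℕ) = l.length) :
    evalList 𝒲 F l = F n fun a => ((l.get (a.cast hn)).2 : W) := by
  cases l with
  | nil => exact absurd hn n.ne_zero
  | cons x l =>
    obtain rfl : n = Nat.succPNat l.length := PNat.eq hn
    rfl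

lemma evalList_ofFn (F : ∀ n : ℕ+, MultilinearMap K (fun _ : Fin n => W) N) (n : ℕ+)
    (u : Fin n → HomEl 𝒲) : evalList 𝒲 F (List.ofFn u) = F n fun a => ((u a).2 : W) := by
  rw [evalList_eq 𝒲 F _ n (by simp)]
  congr 1
  funext a
  exact congrArg (fun z : HomEl 𝒲 => (z.2 : W)) (by simp)

lemma evalList_cons_ofFn (F : ∀ n : ℕ+, MultilinearMap K (fun _ : Fin n => W) N) (n : ℕ)
    (x : HomEl 𝒲) (u : Fin n → HomEl 𝒲) :
    evalList 𝒲 F (x :: List.ofFn u) =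
      F (Nat.succPNat n) (Fin.cons (α := fun _ => W) (x.2 : W) fun a => ((u a).2 : W)) := by
  rw [← List.ofFn_cons]
  refine (evalList_ofFn 𝒲 F (Nat.succPNat n) (Fin.cons x u)).trans ?_
  congr 1
  funext a
  exact Fin.cases rfl (fun a => rfl) a

lemma evalList_cons_of_eq_zero (F : ∀ n : ℕ+, MultilinearMap K (fun _ : Fin n => W) N)
    (x : HomEl 𝒲) (hx : (x.2 : W) = 0) (l : List (HomEl 𝒲)) : evalList 𝒲 F (x :: l) = 0 :=
  (F (Nat.succPNat l.length)).map_coord_zero (0 : Fin (l.length + 1)) hx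

lemma exists_homEl {n : ℕ} (d : Fin n → ℤ) (w : Fin n → W) (hw : ∀ i, w i ∈ 𝒲 (d i)) :
    ∃ u : Fin n → HomEl 𝒲, d = Sigma.fst ∘ u ∧ w = fun a => ((u a).2 : W) :=
  ⟨fun i => ⟨d i, w i, hw i⟩, rfl, rfl⟩

lemma hdeg_ofFn {n : ℕ} (u : Fin n → HomEl 𝒲) : hdeg 𝒲 (List.ofFn u) = ∑ a, (u a).1 := by
  simp [hdeg, listDeg, List.map_ofFn, List.sum_ofFn]

lemma exists_ofFn_eq (l : List (HomEl 𝒲)) (hl : l ≠ []) :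
    ∃ (n : ℕ+) (u : Fin n → HomEl 𝒲), l = List.ofFn u :=
  ⟨⟨l.length, List.length_pos_of_ne_nil hl⟩, l.get, (List.ofFn_get l).symm⟩

/-- Multilinear maps that agree on homogeneous elements are equal. -/
lemma multilinear_ext_homogeneous [DirectSum.Decomposition 𝒲] {n : ℕ}
    {f g : MultilinearMap K (fun _ : Fin n => W) N}
    (h : ∀ (d : Fin n → ℤ) (w : Fin n → W), (∀ i, w i ∈ 𝒲 (d i)) → f w = g w) : f = g := by
  have key : f.compLinearMap (fun _ => (DirectSum.decomposeLinearEquiv 𝒲).symm.toLinearMap) =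
      g.compLinearMap (fun _ => (DirectSum.decomposeLinearEquiv 𝒲).symm.toLinearMap) := by
    refine MultilinearMap.directSum_ext fun p => ?_
    ext x
    simp only [MultilinearMap.compLinearMap_apply, LinearEquiv.coe_coe,
      DirectSum.decomposeLinearEquiv_symm_apply, DirectSum.lof_eq_of, DirectSum.decompose_symm_of]
    exact h p _ fun i => (x i).2
  ext w
  have := congrArg (fun φ => φ fun i => DirectSum.decompose 𝒲 (w i)) key
  simpa only [MultilinearMap.compLinearMap_apply, LinearEquiv.coe_coe,
    DirectSum.decomposeLinearEquiv_symm_apply, Equiv.symm_apply_apply] using this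

/-- The wedge product of a list of homogeneous elements (zero for the empty list). -/
def wedgeList (l : List (HomEl 𝒲)) : CExt 𝒲 := evalList 𝒲 (wedge 𝒲) l

@[simp] lemma wedgeList_nil : wedgeList 𝒲 [] = 0 := rfl

lemma wedgeList_ofFn (n : ℕ+) (u : Fin n → HomEl 𝒲) :
    wedgeList 𝒲 (List.ofFn u) = wedge 𝒲 n fun a => ((u a).2 : W) :=
  evalList_ofFn 𝒲 _ n u

lemma wedgeList_mem (l : List (HomEl 𝒲)) : wedgeList 𝒲 l ∈ extDeg 𝒲 (hdeg 𝒲 l) := by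
  by_cases hl : l = []
  · subst hl
    exact zero_mem _
  · obtain ⟨n, u, rfl⟩ := exists_ofFn_eq 𝒲 l hl
    rw [wedgeList_ofFn, hdeg_ofFn]
    exact Submodule.subset_span ⟨n, _, _, fun i => (u i).2.2, rfl, rfl⟩

lemma extDeg_le {p : ℤ} {S : Submodule K (CExt 𝒲)}
    (h : ∀ l, hdeg 𝒲 l = p → wedgeList 𝒲 l ∈ S) : extDeg 𝒲 p ≤ S := by
  refine Submodule.span_le.mpr ?_
  rintro _ ⟨n, d, w, hw, rfl, rfl⟩
  obtain ⟨u, rfl, rfl⟩ := exists_homEl 𝒲 d w hw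
  rw [← wedgeList_ofFn]
  exact h _ (hdeg_ofFn 𝒲 u)

/-- Linear maps on `ᶜ∧(W)` that agree on products of homogeneous elements are equal. -/
lemma cext_hom_ext [DirectSum.Decomposition 𝒲] {φ ψ : CExt 𝒲 →ₗ[K] N}
    (h : ∀ l, φ (wedgeList 𝒲 l) = ψ (wedgeList 𝒲 l)) : φ = ψ := by
  refine DirectSum.linearMap_ext K fun n => ?_
  refine Submodule.linearMap_qext _ (PiTensorProduct.ext ?_)
  refine multilinear_ext_homogeneous 𝒲 fun d w hw => ?_
  obtain ⟨u, rfl, rfl⟩ := exists_homEl 𝒲 d w hw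
  have := h (List.ofFn u)
  rw [wedgeList_ofFn] at this
  exact this

lemma koszulOp_wedgeList [DirectSum.Decomposition 𝒲] (k : ℤ) (l : List (HomEl 𝒲)) :
    koszulOp 𝒲 k (wedgeList 𝒲 l) = (k * hdeg 𝒲 l).negOnePow • wedgeList 𝒲 l :=
  koszulOp_of_mem 𝒲 k _ _ (wedgeList_mem 𝒲 l)

lemma units_smul_tmul {A B : Type*} [AddCommGroup A] [Module K A] [AddCommGroup B] [Module K B]
    (s : ℤˣ) (a : A) (b : B) : (s • a) ⊗ₜ[K] b = s • a ⊗ₜ[K] b := by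
  rcases Int.units_eq_one_or s with rfl | rfl <;> simp [Units.smul_def, TensorProduct.neg_tmul]

lemma map_units_smul {A B : Type*} [AddCommGroup A] [Module K A] [AddCommGroup B] [Module K B]
    (φ : A →ₗ[K] B) (s : ℤˣ) (a : A) : φ (s • a) = s • φ a := by
  rw [Units.smul_def, map_zsmul, Units.smul_def]

lemma map_splitSum_linear {H : Type*} (δ : H → ℤ) {A B : Type*} [AddCommGroup A] [Module K A]
    [AddCommGroup B] [Module K B] (φ : A →ₗ[K] B) (l : List H) (F : List H → List H → A) :
    φ (splitSum δ l F) = splitSum δ l fun P Q => φ (F P Q) :=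
  map_splitSum δ φ.toAddMonoidHom l F

/-- The reduced comultiplication ranges over proper splittings only. The two trivial ones may be
added because `wedgeList 𝒲 [] = 0`. -/
lemma comul_wedgeList [DirectSum.Decomposition 𝒲] (l : List (HomEl 𝒲)) :
    comul 𝒲 (wedgeList 𝒲 l) =
      splitSum Sigma.fst l fun A B => wedgeList 𝒲 A ⊗ₜ[K] wedgeList 𝒲 B := by
  by_cases hl : l = []
  · subst hl
    simp [splitSum]
  · obtain ⟨n, u, rfl⟩ := exists_ofFn_eq 𝒲 l hl
    obtain ⟨m, rfl⟩ : ∃ m, n = Nat.succPNat m := ⟨n.natPred, (PNat.succPNat_natPred n).symm⟩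
    rw [wedgeList_ofFn, comul_wedge 𝒲 (Nat.succPNat m) _ _ (fun a => (u a).2.2)]
    refine Eq.trans ?_ (sum_unshuffles_eq_splitSum Sigma.fst u _ (by simp))
    symm
    -- The last index is the splitting with empty second block, absent from the comultiplication;
    -- the remaining indices match term by term.
    refine (Fin.sum_univ_castSucc _).trans ?_
    rw [Finset.sum_eq_zero (s := unshuffles (Fin.last m + 1) _ _), add_zero]
    · refine Finset.sum_congr rfl fun i _ => Finset.sum_congr rfl fun σ _ => ?_
      have hi : 0 < m + 1 - (i.val + 1) := by omega
      refine congrArg _ ?_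
      refine congrArg₂ _ ?_ ?_
      · exact wedgeList_ofFn 𝒲 ⟨i.val + 1, by omega⟩ _
      · exact wedgeList_ofFn 𝒲 ⟨m + 1 - (i.val + 1), hi⟩ _
    · intro σ _
      have : (List.ofFn fun b => u (σ (split (Fin.last m + 1) (m + 1) (Fin.last m).2
          (Sum.inr b)))) = [] := by
        rw [← List.length_eq_zero_iff, List.length_ofFn, Fin.val_last, Nat.sub_self]
      refine (congrArg (fun z => koszul σ (Sigma.fst ∘ u) • (_ ⊗ₜ[K] wedgeList 𝒲 z)) this).trans ?_
      rw [wedgeList_nil, TensorProduct.tmul_zero, smul_zero]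

lemma proj_wedgeList_singleton (x : HomEl 𝒲) : proj 𝒲 (wedgeList 𝒲 [x]) = x.2 :=
  proj_wedge_one 𝒲 _

lemma proj_wedgeList_cons_cons (x y : HomEl 𝒲) (l : List (HomEl 𝒲)) :
    proj 𝒲 (wedgeList 𝒲 (x :: y :: l)) = 0 :=
  proj_wedge_of_ne 𝒲 (Nat.succPNat (l.length + 1)) (fun h => by
    have := congrArg PNat.val h
    simp at this) _

lemma proj_mem {p : ℤ} {c : CExt 𝒲} (hc : c ∈ extDeg 𝒲 p) : proj 𝒲 c ∈ 𝒲 p := by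
  have : extDeg 𝒲 p ≤ (𝒲 p).comap (proj 𝒲) := extDeg_le 𝒲 fun l hl => by
    rw [Submodule.mem_comap]
    match l with
    | [] => simp
    | [x] =>
      rw [proj_wedgeList_singleton]
      simp only [hdeg, listDeg_cons, listDeg_nil, add_zero] at hl
      exact hl ▸ x.2.2
    | x :: y :: l => simp [proj_wedgeList_cons_cons]
  exact this hc

end homogeneous

section kernelOfComul

variable {K : Type*} [Field K] {W : Type*} [AddCommGroup W] [Module K W]
variable {N : Type*} [AddCommGroup N] [Module K N] (𝒲 : ℤ → Submodule K W)

/-! ### The kernel of the comultiplication -/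

section kernel

/-- A permutation fixing the first factor has no inversion there, so the degree of `x` does not
enter the sign. This makes left multiplication by `x` well defined on ∧ⁿ. -/
lemma wedge_cons_perm {n : ℕ} (e : ℤ) (x : W) (hx : x ∈ 𝒲 e) (d : Fin n → ℤ) (u : Fin n → W)
    (hu : ∀ i, u i ∈ 𝒲 (d i)) (π : Equiv.Perm (Fin n)) :
    wedge 𝒲 (Nat.succPNat n) (Fin.cons (α := fun _ => W) x u) =
      koszul π d • wedge 𝒲 (Nat.succPNat n) (Fin.cons (α := fun _ => W) x (u ∘ π)) := by
  have h := wedge_perm 𝒲 (Nat.succPNat n) (Fin.cons (α := fun _ => ℤ) e d)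
    (Fin.cons (α := fun _ => W) x u) (Fin.cases hx hu) (consPerm π)
  have e1 := cons_comp_consPerm x u π
  have e2 := koszul_consPerm π e d
  refine h.trans ?_
  exact congrArg₂ (fun (s : ℤˣ) z => s • wedge 𝒲 (Nat.succPNat n) z) e2 e1

/-- `(u₁, …, uₙ) ↦ (w ↦ w ∧ u₁ ∧ ⋯ ∧ uₙ)`. -/
def wedgeCons (n : ℕ) : MultilinearMap K (fun _ : Fin n => W) (W →ₗ[K] CExt 𝒲) :=
  MultilinearMap.mk'
    (fun u =>
      { toFun := fun w => (wedge 𝒲 (Nat.succPNat n)).curryLeft w u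
        map_add' := fun x y => by rw [map_add]; rfl
        map_smul' := fun c x => by rw [map_smul]; rfl })
    (fun u i x y => by
      ext w
      exact ((wedge 𝒲 (Nat.succPNat n)).curryLeft w).map_update_add u i x y)
    (fun u i c x => by
      ext w
      exact ((wedge 𝒲 (Nat.succPNat n)).curryLeft w).map_update_smul u i c x)

lemma wedgeList_swap (x y : HomEl 𝒲) (l : List (HomEl 𝒲)) :
    wedgeList 𝒲 (x :: y :: l) = (x.1 * y.1).negOnePow • wedgeList 𝒲 (y :: x :: l) := by
  obtain ⟨n, u, rfl⟩ : ∃ (n : ℕ) (u : Fin n → HomEl 𝒲), l = List.ofFn u :=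
    ⟨_, l.get, (List.ofFn_get l).symm⟩
  have h := wedge_perm 𝒲 (Nat.succPNat (n + 1))
    (fun a => ((Fin.cons x (Fin.cons y u : Fin (n + 1) → HomEl 𝒲) : Fin (n + 2) → HomEl 𝒲) a).1)
    (fun a => ((Fin.cons x (Fin.cons y u : Fin (n + 1) → HomEl 𝒲) : Fin (n + 2) → HomEl 𝒲) a).2)
    (fun a => ((Fin.cons x (Fin.cons y u : Fin (n + 1) → HomEl 𝒲) : Fin (n + 2) → HomEl 𝒲) a).2.2)
    (Fin.cycleRange (1 : Fin (n + 2)))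
  have e : ∀ v : Fin (n + 2) → HomEl 𝒲, wedge 𝒲 (Nat.succPNat (n + 1)) (fun a => ((v a).2 : W)) =
      wedgeList 𝒲 (List.ofFn v) := fun v => (wedgeList_ofFn 𝒲 (Nat.succPNat (n + 1)) v).symm
  have e1 : koszul (Fin.cycleRange (1 : Fin (n + 2))) (fun a => ((Fin.cons x
      (Fin.cons y u : Fin (n + 1) → HomEl 𝒲) : Fin (n + 2) → HomEl 𝒲) a).1) =
      (x.1 * y.1).negOnePow := by
    have := koszul_cycleRange (1 : Fin (n + 2)) x.1 (Fin.cons y.1 fun a => (u a).1)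
    simp only [Fin.val_one, List.ofFn_cons, List.take_succ_cons, List.take_zero,
      List.sum_singleton] at this
    rw [← this]
    congr 1
    funext a
    refine Fin.cases rfl (fun a => ?_) a
    exact Fin.cases rfl (fun _ => rfl) a
  have e2 : (Fin.cons x (Fin.cons y u : Fin (n + 1) → HomEl 𝒲) : Fin (n + 2) → HomEl 𝒲) ∘
      Fin.cycleRange (1 : Fin (n + 2)) = Fin.cons y (Fin.cons x u : Fin (n + 1) → HomEl 𝒲) := by
    funext a
    refine Fin.cases ?_ (fun a => ?_) a
    · rw [Function.comp_apply, Fin.cycleRange_of_lt (by simp)]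
      simp
    · refine Fin.cases ?_ (fun a => ?_) a
      · simp
      · rw [Function.comp_apply, Fin.cycleRange_of_gt (by simp [Fin.lt_def])]
        simp
  refine (congrArg (wedgeList 𝒲) ?_).trans ((e _).symm.trans (h.trans (congrArg₂ (· • ·) e1
    ((e (_ ∘ Fin.cycleRange (1 : Fin (n + 2)))).trans (congrArg (wedgeList 𝒲) ?_)))))
  · simp
  · exact (congrArg List.ofFn e2).trans (by simp)

lemma component_wedgeList_of_ne (n : ℕ+) (l : List (HomEl 𝒲)) (h : l.length ≠ n) :
    CExt.component 𝒲 n (wedgeList 𝒲 l) = 0 := by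
  by_cases hl : l = []
  · subst hl
    simp
  · obtain ⟨m, u, rfl⟩ := exists_ofFn_eq 𝒲 l hl
    rw [wedgeList_ofFn]
    refine (DirectSum.component.of K (M := fun m : ℕ+ => ExtPow 𝒲 m) n m _).trans (dif_neg ?_)
    rintro rfl
    simp at h

omit [Module K N] in
-- Pulling one letter to the front costs the Koszul sign of its splitting, and `F` changes by the
-- same sign. Each of the possible letters thus contributes one copy of `F l`.
lemma splitSum_singleton (F : List (HomEl 𝒲) → N)
    (hF : ∀ l x y l', F (l ++ x :: y :: l') = (x.1 * y.1).negOnePow • F (l ++ y :: x :: l'))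
    (l : List (HomEl 𝒲)) :
    (splitSum Sigma.fst l fun A B => if A.length = 1 then F (A ++ B) else 0) =
      l.length • F l := by
  induction l generalizing F with
  | nil => simp [splitSum]
  | cons x l ih =>
    rw [splitSum, splitSum_add, splitSum_of_left_ne_nil]
    · rw [show (x :: l).length = l.length + 1 from rfl, succ_nsmul',
        List.length_singleton, if_pos rfl]
      congr 1
      have := ih (fun l => F (x :: l)) fun l y z l' => hF (x :: l) y z l'
      rw [← this]
      refine splitSum_congr _ _ _ _ fun A B _ _ => ?_
      match A with
      | [] => simp
      | [a] =>
        have := hF [] a x B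
        simp only [List.nil_append] at this
        simp only [List.length_singleton, if_true, List.cons_append, List.nil_append, this,
          listDeg_cons, listDeg_nil, add_zero, smul_smul, mul_comm a.1 x.1]
        rw [Int.units_mul_self, one_smul]
      | a :: b :: A => simp
    · intro A B hA
      simp [hA]

variable [DirectSum.Decomposition 𝒲]

lemma linear_ext_homogeneous {f g : W →ₗ[K] N} (h : ∀ p, ∀ w ∈ 𝒲 p, f w = g w) : f = g := by
  ext w
  induction w using DirectSum.Decomposition.inductionOn 𝒲 with
  | zero => simp
  | homogeneous w => exact h _ _ w.2
  | add x y hx hy => rw [map_add, map_add, hx, hy]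

/-- Multiplication on the left by elements of `W`. -/
def leftMul : CExt 𝒲 →ₗ[K] W →ₗ[K] CExt 𝒲 :=
  CExt.lift 𝒲 fun n => extLift 𝒲 n (fun _ => wedgeCons 𝒲 n) fun d u σ hu => by
    refine linear_ext_homogeneous 𝒲 fun p w hw => ?_
    exact wedge_cons_perm 𝒲 p w hw d u hu σ

lemma leftMul_wedgeList (l : List (HomEl 𝒲)) (hl : l ≠ []) (x : HomEl 𝒲) :
    leftMul 𝒲 (wedgeList 𝒲 l) (x.2 : W) = wedgeList 𝒲 (x :: l) := by
  obtain ⟨n, u, rfl⟩ := exists_ofFn_eq 𝒲 l hl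
  rw [wedgeList_ofFn]
  conv_lhs => simp only [leftMul, wedge, LinearMap.compMultilinearMap_apply, LinearMap.comp_apply,
    CExt.lift_incl]
  rw [extLift_mk 𝒲 n _ _ _ _ (fun i => (u i).2.2)]
  exact (evalList_cons_ofFn 𝒲 (wedge 𝒲) n x u).symm

lemma wedgeList_swap_append (l : List (HomEl 𝒲)) (x y : HomEl 𝒲) (l' : List (HomEl 𝒲)) :
    wedgeList 𝒲 (l ++ x :: y :: l') =
      (x.1 * y.1).negOnePow • wedgeList 𝒲 (l ++ y :: x :: l') := by
  induction l with
  | nil => exact wedgeList_swap 𝒲 x y l'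
  | cons z l ih =>
    rw [List.cons_append, List.cons_append, ← leftMul_wedgeList 𝒲 _ (by simp),
      ← leftMul_wedgeList 𝒲 _ (by simp), ih, map_units_smul]
    rfl

/-- The operator multiplying `∧ⁿ W` by `n`, in terms of the comultiplication and the projection
to `W`. -/
def countOp : CExt 𝒲 →ₗ[K] CExt 𝒲 :=
  TensorProduct.lift ((leftMul 𝒲).flip ∘ₗ proj 𝒲) ∘ₗ comul 𝒲 +
    wedgeCons 𝒲 0 Fin.elim0 ∘ₗ proj 𝒲

/-- After Δ the projection keeps the splittings whose first part is one letter, and `leftMul` puts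
that letter back. Words of length one are killed by the reduced Δ, and the second summand of
`countOp` accounts for them. -/
lemma countOp_wedgeList (l : List (HomEl 𝒲)) :
    countOp 𝒲 (wedgeList 𝒲 l) = l.length • wedgeList 𝒲 l := by
  rw [countOp, LinearMap.add_apply, LinearMap.comp_apply, LinearMap.comp_apply, comul_wedgeList,
    map_splitSum_linear]
  simp only [TensorProduct.lift.tmul, LinearMap.comp_apply, LinearMap.flip_apply]
  match l with
  | [] => simp [splitSum]
  | [x] =>
    simp only [splitSum, wedgeList_nil, map_zero, LinearMap.zero_apply, smul_zero, add_zero,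
      proj_wedgeList_singleton, zero_add, List.length_singleton, one_smul]
    refine Eq.trans ?_ (evalList_cons_ofFn 𝒲 (wedge 𝒲) 0 x Fin.elim0).symm
    exact congrArg (fun u => wedgeCons 𝒲 0 u (x.2 : W)) (Subsingleton.elim _ _)
  | x :: y :: l =>
    rw [proj_wedgeList_cons_cons, map_zero, add_zero,
      ← splitSum_singleton 𝒲 (wedgeList 𝒲) (wedgeList_swap_append 𝒲)]
    refine splitSum_congr _ _ _ _ fun A B _ h => ?_
    match A with
    | [] => simp
    | [a] =>
      have hB : B ≠ [] := by
        rintro rfl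
        simp at h
      rw [proj_wedgeList_singleton, leftMul_wedgeList 𝒲 B hB]
      simp
    | a :: b :: A => simp [proj_wedgeList_cons_cons]

lemma component_countOp (n : ℕ+) (c : CExt 𝒲) :
    CExt.component 𝒲 n (countOp 𝒲 c) = (n : ℕ) • CExt.component 𝒲 n c := by
  have : CExt.component 𝒲 n ∘ₗ countOp 𝒲 = (n : ℕ) • CExt.component 𝒲 n :=
    cext_hom_ext 𝒲 fun l => by
      rw [LinearMap.comp_apply, countOp_wedgeList, map_nsmul, LinearMap.smul_apply]
      by_cases h : l.length = n
      · rw [h]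
      · rw [component_wedgeList_of_ne 𝒲 n l h, smul_zero, smul_zero]
  exact congrArg (fun φ => φ c) this

/-- In characteristic zero, the kernel of the comultiplication meets the kernel of the projection
to `W` trivially. -/
lemma eq_zero_of_comul_eq_zero [CharZero K] (c : CExt 𝒲) (h : comul 𝒲 c = 0)
    (h' : proj 𝒲 c = 0) : c = 0 := by
  refine DirectSum.ext_component K fun n => ?_
  -- `countOp` only sees Δ c and the projection of c, so n times the n-th component of c vanishes
  -- for every n.
  have h0 : countOp 𝒲 c = 0 := by simp [countOp, h, h']
  have := component_countOp 𝒲 n c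
  rw [h0, map_zero, ← Nat.cast_smul_eq_nsmul K] at this
  exact ((smul_eq_zero.mp this.symm).resolve_left (by simp)).trans (map_zero _).symm

/-- A linear map satisfying a twisted Leibniz rule vanishes if its component in `W` does. -/
lemma eq_zero_of_leibniz [CharZero K] (θ κ : CExt 𝒲 →ₗ[K] CExt 𝒲)
    (hθ : ∀ c, comul 𝒲 (θ c) = TensorProduct.map θ LinearMap.id (comul 𝒲 c) +
      TensorProduct.map κ θ (comul 𝒲 c))
    (h : proj 𝒲 ∘ₗ θ = 0) : θ = 0 := by
  refine cext_hom_ext 𝒲 fun l => ?_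
  induction hn : l.length using Nat.strong_induction_on generalizing l with
  | _ n ih =>
    refine eq_zero_of_comul_eq_zero 𝒲 _ ?_ (congrArg (fun φ => φ (wedgeList 𝒲 l)) h)
    rw [hθ, comul_wedgeList, map_splitSum_linear, map_splitSum_linear, ← splitSum_add,
      ← splitSum_zero Sigma.fst l]
    refine splitSum_congr _ _ _ _ fun A B _ hAB => ?_
    rw [TensorProduct.map_tmul, TensorProduct.map_tmul]
    -- Trivial splittings contribute zero. In the others both parts are shorter than `l`, and θ
    -- kills them by induction, whatever the twist κ is.
    by_cases hA : A = []
    · subst hA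
      simp
    by_cases hB : B = []
    · subst hB
      simp
    have hA' := List.length_pos_of_ne_nil hA
    have hB' := List.length_pos_of_ne_nil hB
    rw [ih A.length (by omega) A rfl, ih B.length (by omega) B rfl]
    simp

end kernel

end kernelOfComul

section extension

variable {K : Type*} [Field K] {W : Type*} [AddCommGroup W] [Module K W]
variable (𝒲 : ℤ → Submodule K W)

/-! ### Coderivations from their corestrictions -/

section coderivation

/-- Graded-symmetric families of multilinear maps of degree `1`. -/
structure IsSymmFamily (f : ∀ n : ℕ+, MultilinearMap K (fun _ : Fin n => W) W) : Prop where
  degree : ∀ (n : ℕ+) (d : Fin n → ℤ) (w : Fin n → W), (∀ i, w i ∈ 𝒲 (d i)) →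
    f n w ∈ 𝒲 (∑ i, d i + 1)
  symm : ∀ (n : ℕ+) (d : Fin n → ℤ) (w : Fin n → W), (∀ i, w i ∈ 𝒲 (d i)) →
    ∀ σ : Equiv.Perm (Fin n), f n w = koszul σ d • f n (w ∘ σ)

/-- `(w₁, …, wₙ) ↦ f (w_{σ 1}, …, w_{σ (i+1)}) ∧ w_{σ (i+2)} ∧ ⋯ ∧ w_{σ n}`. -/
def insertTerm (f : ∀ n : ℕ+, MultilinearMap K (fun _ : Fin n => W) W) (n i : ℕ) (hi : i < n)
    (σ : Equiv.Perm (Fin n)) : MultilinearMap K (fun _ : Fin n => W) (CExt 𝒲) :=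
  (MultilinearMap.uncurrySum (N := fun _ : Fin (i + 1) ⊕ Fin (n - (i + 1)) => W)
    ((wedge 𝒲 (Nat.succPNat (n - (i + 1)))).curryLeft.compMultilinearMap
      (f (Nat.succPNat i)))).domDomCongr ((split (i + 1) n hi).trans σ)

lemma insertTerm_apply (f : ∀ n : ℕ+, MultilinearMap K (fun _ : Fin n => W) W) (n i : ℕ)
    (hi : i < n) (σ : Equiv.Perm (Fin n)) (w : Fin n → W) :
    insertTerm 𝒲 f n i hi σ w = wedge 𝒲 (Nat.succPNat (n - (i + 1)))
      (Fin.cons (α := fun _ => W)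
        (f (Nat.succPNat i) fun a => w (σ (split (i + 1) n hi (Sum.inl a))))
        fun b => w (σ (split (i + 1) n hi (Sum.inr b)))) := rfl

/-- For degrees `d`, the multilinear map
`(w₁, …, wₙ) ↦ ∑ᵢ ∑_σ ε(σ) f (w_{σ 1}, …, w_{σ i}) ∧ w_{σ (i+1)} ∧ ⋯ ∧ w_{σ n}`. -/
def insertFamily (f : ∀ n : ℕ+, MultilinearMap K (fun _ : Fin n => W) W) (n : ℕ)
    (d : Fin n → ℤ) : MultilinearMap K (fun _ : Fin n => W) (CExt 𝒲) :=
  ∑ i : Fin n, ∑ σ ∈ unshuffles (i + 1) n i.2, koszul σ d • insertTerm 𝒲 f n i i.2 σ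

variable {𝒲} {f : ∀ n : ℕ+, MultilinearMap K (fun _ : Fin n => W) W}

/-- Reordering inside each block is absorbed by the symmetry of `f` and of the wedge product. This
is the invariance required by `sum_unshuffles_mul`, and it gives the symmetry of `insertFamily`. -/
lemma insertTerm_block (hf : IsSymmFamily 𝒲 f) (n i : ℕ) (hi : i < n)
    (ρ : Equiv.Perm (Fin n)) (π₁ : Equiv.Perm (Fin (i + 1)))
    (π₂ : Equiv.Perm (Fin (n - (i + 1)))) (d : Fin n → ℤ) (w : Fin n → W)
    (hw : ∀ i, w i ∈ 𝒲 (d i)) :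
    koszul (ρ * block hi π₁ π₂) d • insertTerm 𝒲 f n i hi (ρ * block hi π₁ π₂) w
      = koszul ρ d • insertTerm 𝒲 f n i hi ρ w := by
  have h1 := hf.symm (Nat.succPNat i) (fun a => d (ρ (split (i + 1) n hi (Sum.inl a))))
    (fun a => w (ρ (split (i + 1) n hi (Sum.inl a)))) (fun a => hw _) π₁
  have hx := hf.degree (Nat.succPNat i) _ ((fun a => w (ρ (split (i + 1) n hi (Sum.inl a)))) ∘ π₁)
    (fun a => hw (ρ (split (i + 1) n hi (Sum.inl (π₁ a)))))
  have h2 := wedge_cons_perm 𝒲 _ _ hx (fun a => d (ρ (split (i + 1) n hi (Sum.inr a))))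
    (fun a => w (ρ (split (i + 1) n hi (Sum.inr a)))) (fun a => hw _) π₂
  have e1 : (fun a : Fin (i + 1) => w ((ρ * block hi π₁ π₂) (split (i + 1) n hi (Sum.inl a))))
      = (fun a => w (ρ (split (i + 1) n hi (Sum.inl a)))) ∘ π₁ := by
    funext a
    simp only [Equiv.Perm.mul_apply, block_inl, Function.comp_apply]
  have e2 : (fun a : Fin (n - (i + 1)) =>
      w ((ρ * block hi π₁ π₂) (split (i + 1) n hi (Sum.inr a))))
      = (fun a => w (ρ (split (i + 1) n hi (Sum.inr a)))) ∘ π₂ := by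
    funext a
    simp only [Equiv.Perm.mul_apply, block_inr, Function.comp_apply]
  have e3 : insertTerm 𝒲 f n i hi (ρ * block hi π₁ π₂) w =
      wedge 𝒲 (Nat.succPNat (n - (i + 1))) (Fin.cons (α := fun _ => W)
        (f (Nat.succPNat i) ((fun a => w (ρ (split (i + 1) n hi (Sum.inl a)))) ∘ π₁))
        ((fun a => w (ρ (split (i + 1) n hi (Sum.inr a)))) ∘ π₂)) :=
    congrArg₂ (fun u v => wedge 𝒲 (Nat.succPNat (n - (i + 1))) (Fin.cons (α := fun _ => W)
        (f (Nat.succPNat i) u) v)) e1 e2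
  have e4 : insertTerm 𝒲 f n i hi ρ w =
      (koszul π₁ fun a => d (ρ (split (i + 1) n hi (Sum.inl a)))) •
      wedge 𝒲 (Nat.succPNat (n - (i + 1))) (Fin.cons (α := fun _ => W)
        (f (Nat.succPNat i) ((fun a => w (ρ (split (i + 1) n hi (Sum.inl a)))) ∘ π₁))
        (fun a => w (ρ (split (i + 1) n hi (Sum.inr a))))) := by
    rw [insertTerm_apply, h1]
    exact map_units_smul (wedgeCons 𝒲 (n - (i + 1))
      (fun a => w (ρ (split (i + 1) n hi (Sum.inr a))))) _ _
  rw [e3, e4, h2, koszul_mul, koszul_block, mul_smul, mul_smul]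
  rfl

lemma insertFamily_perm (hf : IsSymmFamily 𝒲 f) (n : ℕ) (d : Fin n → ℤ) (w : Fin n → W)
    (τ : Equiv.Perm (Fin n)) (hw : ∀ i, w i ∈ 𝒲 (d i)) :
    insertFamily 𝒲 f n d w = koszul τ d • insertFamily 𝒲 f n (d ∘ τ) (w ∘ τ) := by
  simp only [insertFamily, sum_apply, Finset.smul_sum]
  refine Finset.sum_congr rfl fun i _ => ?_
  rw [← sum_unshuffles_mul i.2
    (fun σ => (koszul σ d • insertTerm 𝒲 f n i i.2 σ) w)
    (fun ρ π₁ π₂ => insertTerm_block hf n i i.2 ρ π₁ π₂ d w hw) τ]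
  refine Finset.sum_congr rfl fun σ _ => ?_
  rw [koszul_mul, mul_smul]
  rfl

variable [DirectSum.Decomposition 𝒲]

/-- The coderivation with corestrictions `f`. -/
def coderivation (hf : IsSymmFamily 𝒲 f) : CExt 𝒲 →ₗ[K] CExt 𝒲 :=
  CExt.lift 𝒲 fun n =>
    extLift 𝒲 n (insertFamily 𝒲 f n) fun d w σ hw => insertFamily_perm hf n d w σ hw

lemma coderivation_wedge (hf : IsSymmFamily 𝒲 f) (n : ℕ+) (d : Fin n → ℤ) (w : Fin n → W)
    (hw : ∀ i, w i ∈ 𝒲 (d i)) : coderivation hf (wedge 𝒲 n w) = insertFamily 𝒲 f n d w := by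
  simp only [coderivation, wedge, LinearMap.compMultilinearMap_apply, LinearMap.comp_apply,
    CExt.lift_incl]
  rw [extLift_mk 𝒲 n _ _ d w hw]

omit [DirectSum.Decomposition 𝒲] in
lemma IsSymmFamily.evalList_mem (hf : IsSymmFamily 𝒲 f) (l : List (HomEl 𝒲)) :
    evalList 𝒲 f l ∈ 𝒲 (hdeg 𝒲 l + 1) := by
  by_cases hl : l = []
  · subst hl
    exact zero_mem _
  · obtain ⟨n, u, rfl⟩ := exists_ofFn_eq 𝒲 l hl
    rw [evalList_ofFn, hdeg_ofFn]
    exact hf.degree n _ _ fun i => (u i).2.2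

/-- The homogeneous element `f (w₁, …, wₙ)`. -/
def IsSymmFamily.apply (hf : IsSymmFamily 𝒲 f) (l : List (HomEl 𝒲)) : HomEl 𝒲 :=
  ⟨hdeg 𝒲 l + 1, evalList 𝒲 f l, hf.evalList_mem l⟩

lemma coderivation_wedgeList (hf : IsSymmFamily 𝒲 f) (l : List (HomEl 𝒲)) :
    coderivation hf (wedgeList 𝒲 l) =
      splitSum Sigma.fst l fun A B => wedgeList 𝒲 (hf.apply A :: B) := by
  have h0 : ∀ B, wedgeList 𝒲 (hf.apply [] :: B) = 0 := fun B =>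
    evalList_cons_of_eq_zero 𝒲 _ _ rfl _
  by_cases hl : l = []
  · subst hl
    simp [splitSum, h0]
  · obtain ⟨n, u, rfl⟩ := exists_ofFn_eq 𝒲 l hl
    rw [wedgeList_ofFn, coderivation_wedge hf n _ _ (fun i => (u i).2.2),
      ← sum_unshuffles_eq_splitSum Sigma.fst u _ h0]
    simp only [insertFamily, sum_apply]
    refine Finset.sum_congr rfl fun i _ => Finset.sum_congr rfl fun σ _ => ?_
    refine congrArg (fun z : CExt 𝒲 => koszul σ (Sigma.fst ∘ u) • z) ?_
    rw [insertTerm_apply]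
    refine Eq.trans ?_ (evalList_cons_ofFn 𝒲 (wedge 𝒲) _ _ _).symm
    refine congrArg (fun z => wedge 𝒲 (Nat.succPNat (n - (i + 1)))
      (Fin.cons (α := fun _ => W) z _)) ?_
    exact (evalList_ofFn 𝒲 f (Nat.succPNat i) _).symm

/-- Only the splitting with empty second part yields a word of length one. -/
lemma proj_coderivation (hf : IsSymmFamily 𝒲 f) (l : List (HomEl 𝒲)) :
    proj 𝒲 (coderivation hf (wedgeList 𝒲 l)) = evalList 𝒲 f l := by
  rw [coderivation_wedgeList, map_splitSum_linear, splitSum_of_right_ne_nil]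
  · exact proj_wedgeList_singleton 𝒲 _
  · intro A B hB
    match B with
    | [] => exact absurd rfl hB
    | b :: B => exact proj_wedgeList_cons_cons 𝒲 _ _ _

lemma corestriction_coderivation (hf : IsSymmFamily 𝒲 f) (n : ℕ+) :
    corestriction 𝒲 (coderivation hf) n = f n := by
  refine multilinear_ext_homogeneous 𝒲 fun d w hw => ?_
  obtain ⟨u, rfl, rfl⟩ := exists_homEl 𝒲 d w hw
  rw [← evalList_ofFn 𝒲 f, ← proj_coderivation hf, wedgeList_ofFn]
  rfl

lemma comul_wedgeList_cons (x : HomEl 𝒲) (l : List (HomEl 𝒲)) :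
    comul 𝒲 (wedgeList 𝒲 (x :: l)) = splitSum Sigma.fst l fun C D =>
      wedgeList 𝒲 (x :: C) ⊗ₜ[K] wedgeList 𝒲 D +
        (x.1 * hdeg 𝒲 C).negOnePow • wedgeList 𝒲 C ⊗ₜ[K] wedgeList 𝒲 (x :: D) :=
  comul_wedgeList 𝒲 (x :: l)

/-- Both sides become sums over splittings into three parts A, C, D with `f` applied to A. In Δθ the
letter f(A) joins C or D, and this gives the two terms on the right. -/
lemma coderivation_leibniz (hf : IsSymmFamily 𝒲 f) (c : CExt 𝒲) :
    comul 𝒲 (coderivation hf c) =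
      TensorProduct.map (coderivation hf) LinearMap.id (comul 𝒲 c) +
        TensorProduct.map (koszulOp 𝒲 1) (coderivation hf) (comul 𝒲 c) := by
  have key : comul 𝒲 ∘ₗ coderivation hf =
      TensorProduct.map (coderivation hf) LinearMap.id ∘ₗ comul 𝒲 +
        TensorProduct.map (koszulOp 𝒲 1) (coderivation hf) ∘ₗ comul 𝒲 := by
    refine cext_hom_ext 𝒲 fun l => ?_
    have h1 : ∀ E D, TensorProduct.map (coderivation hf) LinearMap.id
        (wedgeList 𝒲 E ⊗ₜ[K] wedgeList 𝒲 D) = splitSum Sigma.fst E fun A C =>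
          wedgeList 𝒲 (hf.apply A :: C) ⊗ₜ[K] wedgeList 𝒲 D := fun E D => by
      rw [TensorProduct.map_tmul, coderivation_wedgeList]
      exact map_splitSum_linear _ ((TensorProduct.mk K _ _).flip (wedgeList 𝒲 D)) _ _
    have h2 : ∀ C E, TensorProduct.map (koszulOp 𝒲 1) (coderivation hf)
        (wedgeList 𝒲 C ⊗ₜ[K] wedgeList 𝒲 E) = splitSum Sigma.fst E fun A D =>
          (1 * hdeg 𝒲 C).negOnePow •
            wedgeList 𝒲 C ⊗ₜ[K] wedgeList 𝒲 (hf.apply A :: D) := fun C E => by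
      rw [TensorProduct.map_tmul, coderivation_wedgeList, koszulOp_wedgeList]
      simp only [← units_smul_tmul]
      exact map_splitSum_linear _ (TensorProduct.mk K (CExt 𝒲) (CExt 𝒲) _) _ _
    rw [LinearMap.add_apply, LinearMap.comp_apply, LinearMap.comp_apply, LinearMap.comp_apply,
      coderivation_wedgeList, map_splitSum_linear, comul_wedgeList, map_splitSum_linear,
      map_splitSum_linear]
    simp only [h1, h2, comul_wedgeList_cons]
    -- In the second term the parts come in the order C, A, D. They are regrouped, C and A are
    -- exchanged, and the sign of the exchange together with that of θ passing C is the sign of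
    -- f(A), of degree |A| + 1, passing C.
    rw [splitSum_assoc Sigma.fst l (fun C A D => (1 * hdeg 𝒲 C).negOnePow •
      wedgeList 𝒲 C ⊗ₜ[K] wedgeList 𝒲 (hf.apply A :: D))]
    conv_rhs =>
      enter [2, 3, E, D]
      rw [splitSum_comm]
    rw [← splitSum_assoc, ← splitSum_assoc, ← splitSum_add]
    refine splitSum_congr _ _ _ _ fun A B _ _ => ?_
    rw [← splitSum_add]
    refine splitSum_congr _ _ _ _ fun C D _ _ => ?_
    rw [smul_smul, ← Int.negOnePow_add]
    congr 3
    simp only [IsSymmFamily.apply]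
    ring
  exact congrArg (fun φ => φ c) key

lemma coderivation_isCoderivation (hf : IsSymmFamily 𝒲 f) :
    IsCoderivation 𝒲 1 (coderivation hf) where
  degree p c hc := by
    have : extDeg 𝒲 p ≤ (extDeg 𝒲 (p + 1)).comap (coderivation hf) :=
      extDeg_le 𝒲 fun l hl => by
        rw [Submodule.mem_comap, coderivation_wedgeList]
        refine splitSum_mem _ (extDeg 𝒲 (p + 1)).toAddSubgroup _ _ fun A B h => ?_
        have := wedgeList_mem 𝒲 (hf.apply A :: B)
        rwa [show hdeg 𝒲 (hf.apply A :: B) = p + 1 by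
          rw [hdeg, listDeg_cons, ← hl, hdeg, ← h, IsSymmFamily.apply]
          ring] at this
    exact this hc
  leibniz := coderivation_leibniz hf

/-- The square of an odd coderivation satisfies a twisted Leibniz rule. -/
lemma IsCoderivation.leibniz_comp_self {θ : CExt 𝒲 →ₗ[K] CExt 𝒲} (hθ : IsCoderivation 𝒲 1 θ)
    (c : CExt 𝒲) : comul 𝒲 ((θ ∘ₗ θ) c) =
      TensorProduct.map (θ ∘ₗ θ) LinearMap.id (comul 𝒲 c) +
        TensorProduct.map (koszulOp 𝒲 1 ∘ₗ koszulOp 𝒲 1) (θ ∘ₗ θ) (comul 𝒲 c) := by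
  -- Since θ is odd it anticommutes with the parity operator, which cancels the two mixed terms θκ ⊗
  -- θ and κθ ⊗ θ.
  have h : koszulOp 𝒲 1 ∘ₗ θ = -(θ ∘ₗ koszulOp 𝒲 1) := by
    refine cext_hom_ext 𝒲 fun l => ?_
    rw [LinearMap.neg_apply, LinearMap.comp_apply, LinearMap.comp_apply,
      koszulOp_of_mem 𝒲 1 _ _ (hθ.degree _ _ (wedgeList_mem 𝒲 l)), koszulOp_wedgeList,
      map_units_smul, mul_add, Int.negOnePow_add, mul_one, Int.negOnePow_one, mul_neg, mul_one,
      Units.neg_smul]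
  rw [LinearMap.comp_apply, hθ.leibniz, hθ.leibniz]
  induction comul 𝒲 c with
  | zero => simp
  | add x y hx hy =>
    simp only [map_add] at hx hy ⊢
    refine Eq.trans ?_ ((congrArg₂ (fun p q => p + q) hx hy).trans ?_) <;> abel
  | tmul a b =>
    have ha : koszulOp 𝒲 1 (θ a) = -θ (koszulOp 𝒲 1 a) := congrArg (fun φ => φ a) h
    simp [ha, TensorProduct.neg_tmul, add_assoc]

/-- A coderivation of degree `1` is determined by its corestrictions. -/
lemma IsCoderivation.ext_corestriction [CharZero K] {θ θ' : CExt 𝒲 →ₗ[K] CExt 𝒲}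
    (hθ : IsCoderivation 𝒲 1 θ) (hθ' : IsCoderivation 𝒲 1 θ')
    (h : ∀ n, corestriction 𝒲 θ n = corestriction 𝒲 θ' n) : θ = θ' := by
  rw [← sub_eq_zero]
  -- For a fixed twist the Leibniz rule is linear in θ, so the difference satisfies it too.
  refine eq_zero_of_leibniz 𝒲 _ (koszulOp 𝒲 1) (fun c => ?_) (cext_hom_ext 𝒲 fun l => ?_)
  · rw [LinearMap.sub_apply, map_sub, hθ.leibniz, hθ'.leibniz]
    induction comul 𝒲 c with
    | zero => simp
    | add x y hx hy =>
      simp only [map_add] at hx hy ⊢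
      refine Eq.trans ?_ ((congrArg₂ (fun p q => p + q) hx hy).trans ?_) <;> abel
    | tmul a b =>
      simp only [TensorProduct.map_tmul, LinearMap.sub_apply, TensorProduct.sub_tmul,
        TensorProduct.tmul_sub, LinearMap.id_apply]
      abel
  · by_cases hl : l = []
    · subst hl
      simp
    · obtain ⟨n, u, rfl⟩ := exists_ofFn_eq 𝒲 l hl
      rw [wedgeList_ofFn, LinearMap.comp_apply, LinearMap.sub_apply, map_sub,
        LinearMap.zero_apply, sub_eq_zero]
      exact congrArg (fun φ => φ fun a => ((u a).2 : W)) (h n)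

lemma IsCoderivation.isSymmFamily {θ : CExt 𝒲 →ₗ[K] CExt 𝒲} (hθ : IsCoderivation 𝒲 1 θ) :
    IsSymmFamily 𝒲 (corestriction 𝒲 θ) where
  degree n d w hw := proj_mem 𝒲 (hθ.degree _ _ (Submodule.subset_span ⟨n, d, w, hw, rfl, rfl⟩))
  symm n d w hw σ := by
    refine (congrArg (proj 𝒲 ∘ₗ θ) (wedge_perm 𝒲 n d w hw σ)).trans ?_
    exact map_units_smul _ _ _

lemma IsCoderivation.eq_coderivation [CharZero K] {θ : CExt 𝒲 →ₗ[K] CExt 𝒲}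
    (hθ : IsCoderivation 𝒲 1 θ) : coderivation hθ.isSymmFamily = θ :=
  (coderivation_isCoderivation _).ext_corestriction hθ fun n =>
    corestriction_coderivation hθ.isSymmFamily n

/-- The square of a coderivation vanishes iff its corestrictions satisfy quadratic relations. -/
lemma coderivation_comp_self_eq_zero_iff [CharZero K] (hf : IsSymmFamily 𝒲 f) :
    coderivation hf ∘ₗ coderivation hf = 0 ↔
      ∀ (n : ℕ) (d : Fin n → ℤ) (w : Fin n → W), (∀ a, w a ∈ 𝒲 (d a)) →
        ∑ i : Fin n, ∑ σ ∈ unshuffles (i + 1) n i.2, koszul σ d •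
          f (Nat.succPNat (n - (i + 1))) (Fin.cons (α := fun _ => W)
            (f (Nat.succPNat i) fun a => w (σ (split (i + 1) n i.2 (Sum.inl a))))
            fun b => w (σ (split (i + 1) n i.2 (Sum.inr b)))) = 0 := by
  have key : ∀ (n : ℕ) (u : Fin n → HomEl 𝒲),
      proj 𝒲 (coderivation hf (coderivation hf (wedgeList 𝒲 (List.ofFn u)))) =
        ∑ i : Fin n, ∑ σ ∈ unshuffles (i + 1) n i.2, koszul σ (Sigma.fst ∘ u) •
          f (Nat.succPNat (n - (i + 1))) (Fin.cons (α := fun _ => W)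
            (f (Nat.succPNat i) fun a => ((u (σ (split (i + 1) n i.2 (Sum.inl a)))).2 : W))
            fun b => ((u (σ (split (i + 1) n i.2 (Sum.inr b)))).2 : W)) := by
    intro n u
    have h0 : ∀ B, evalList 𝒲 f (hf.apply [] :: B) = 0 := fun B =>
      evalList_cons_of_eq_zero 𝒲 _ _ rfl _
    rw [coderivation_wedgeList, map_splitSum_linear, map_splitSum_linear]
    simp only [proj_coderivation]
    rw [← sum_unshuffles_eq_splitSum Sigma.fst u _ h0]
    refine Finset.sum_congr rfl fun i _ => Finset.sum_congr rfl fun σ _ => ?_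
    refine congrArg (fun z : W => koszul σ (Sigma.fst ∘ u) • z) ?_
    refine (evalList_cons_ofFn 𝒲 f _ _ _).trans ?_
    refine congrArg (fun z => f (Nat.succPNat (n - (i + 1)))
      (Fin.cons (α := fun _ => W) z _)) ?_
    exact evalList_ofFn 𝒲 f (Nat.succPNat i) _
  constructor
  · intro h n d w hw
    obtain ⟨u, rfl, rfl⟩ := exists_homEl 𝒲 d w hw
    rw [← key, ← LinearMap.comp_apply (coderivation hf), h]
    simp
  · intro h
    refine eq_zero_of_leibniz 𝒲 _ _ (coderivation_isCoderivation hf).leibniz_comp_self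
      (cext_hom_ext 𝒲 fun l => ?_)
    obtain ⟨n, u, rfl⟩ : ∃ (n : ℕ) (u : Fin n → HomEl 𝒲), l = List.ofFn u :=
      ⟨_, l.get, (List.ofFn_get l).symm⟩
    rw [LinearMap.comp_apply, LinearMap.comp_apply, LinearMap.zero_apply, key]
    exact h n (Sigma.fst ∘ u) (fun a => ((u a).2 : W)) fun a => (u a).2.2

end coderivation

end extension

/-! ### Signs of the desuspension -/

section signs

lemma desuspSign_eq_prod {n : ℕ} (d : Fin n → ℤ) :
    desuspSign d = ∏ a, ∏ b, if a < b then (d a).negOnePow else 1 := by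
  refine Finset.prod_congr rfl fun a _ => ?_
  rw [← Finset.prod_filter, ← negOnePow_sum, Finset.sum_const]
  congr 1
  have : (Finset.univ.filter fun b => a < b).card = n - 1 - a := by
    rw [← Fin.card_Ioi]
    congr 1
    ext b
    simp
  rw [this, nsmul_eq_mul]
  congr 1
  have := a.2
  omega

lemma sign_eq_prod {n : ℕ} (σ : Equiv.Perm (Fin n)) :
    Equiv.Perm.sign σ = ∏ a, ∏ b, if a < b then (if σ a < σ b then 1 else -1 : ℤˣ) else 1 := by
  rw [Equiv.Perm.sign_eq_prod_prod_Ioi]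
  refine Finset.prod_congr rfl fun a _ => ?_
  rw [← Finset.prod_filter]
  refine Finset.prod_congr ?_ fun _ _ => rfl
  ext b
  simp

/-- The identity holds pair by pair once `desuspSign d` is reindexed along σ. For an inverted pair
with degrees p = d (σ a), q = d (σ b) it reads 1 + pq + p ≡ (p - 1)(q - 1) + q mod 2; for the other
pairs both sides agree. -/
lemma antiKoszul_mul_desuspSign {n : ℕ} (σ : Equiv.Perm (Fin n)) (d : Fin n → ℤ) :
    antiKoszul σ d * desuspSign (d ∘ σ) = koszul σ (fun a => d a - 1) * desuspSign d := by
  have h : desuspSign d =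
      ∏ a, ∏ b, if a < b then (d (min (σ a) (σ b))).negOnePow else 1 := by
    rw [← prod_order_eq (fun a b => (d (min (σ a) (σ b))).negOnePow)
      (fun a b => by rw [min_comm]) σ, desuspSign_eq_prod, ← Equiv.prod_comp σ]
    refine Finset.prod_congr rfl fun a _ => ?_
    rw [← Equiv.prod_comp σ]
    refine Finset.prod_congr rfl fun b _ => ?_
    by_cases hab : σ a < σ b
    · simp [hab, min_eq_left hab.le]
    · simp [hab]
  rw [h, antiKoszul, sign_eq_prod, desuspSign_eq_prod]
  unfold koszul
  simp only [← Finset.prod_mul_distrib]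
  refine Finset.prod_congr rfl fun a _ => Finset.prod_congr rfl fun b _ => ?_
  by_cases hab : a < b
  · rcases lt_or_gt_of_ne (fun e => hab.ne (σ.injective e) : σ a ≠ σ b) with h1 | h1
    · simp [hab, h1, h1.not_gt, min_eq_left h1.le]
    · simp only [hab, h1, h1.not_gt, min_eq_right h1.le, if_true, if_false, and_self,
        Function.comp_apply]
      rw [← Int.negOnePow_one, ← Int.negOnePow_add, ← Int.negOnePow_add, ← Int.negOnePow_add,
        Int.negOnePow_eq_iff]
      exact ⟨d (σ a), by ring⟩
  · simp [hab]

lemma koszul_mul_desuspSign {n : ℕ} (σ : Equiv.Perm (Fin n)) (d : Fin n → ℤ) :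
    koszul σ (fun a => d a - 1) * desuspSign (d ∘ σ) = antiKoszul σ d * desuspSign d := by
  have h := antiKoszul_mul_desuspSign σ d
  rw [← eq_mul_inv_iff_mul_eq, Int.units_inv_eq_self] at h
  rw [h, mul_assoc, mul_assoc, mul_comm (desuspSign (d ∘ σ)), ← mul_assoc (desuspSign d),
    Int.units_mul_self, one_mul]

/-- The sign relating `lₙ` to the `n`-th corestriction. -/
def twistSign {n : ℕ} (d : Fin n → ℤ) : ℤˣ := (-1) ^ (n + 1).choose 2 * desuspSign d

lemma koszul_mul_twistSign {n : ℕ} (σ : Equiv.Perm (Fin n)) (d : Fin n → ℤ) :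
    koszul σ (fun a => d a - 1) * twistSign (d ∘ σ) = antiKoszul σ d * twistSign d := by
  rw [twistSign, twistSign, mul_left_comm, koszul_mul_desuspSign, mul_left_comm]

lemma choose_two_add (j m : ℕ) :
    (j + 1).choose 2 + (m + 1).choose 2 + m * j = (j + m + 1).choose 2 := by
  induction m with
  | zero => simp
  | succ m ih =>
    rw [Nat.choose_succ_succ' (m + 1) 1, Nat.choose_succ_succ' (j + (m + 1)) 1, ← add_assoc j m 1,
      ← ih, Nat.choose_one_right, Nat.choose_one_right]
    ring

/-- Each inner input passes the `n - (i + 1)` outer desuspensions as part of the inner output. The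
output also carries the degree `2 - (i + 1)` of the inner operation past them, which is the extra
sign. -/
lemma desuspSign_split {n i : ℕ} (hi : i < n) (D : Fin n → ℤ) :
    desuspSign (Fin.cons (∑ a, D (split (i + 1) n hi (Sum.inl a)) + (2 - ((i + 1 : ℕ) : ℤ)))
      (fun b => D (split (i + 1) n hi (Sum.inr b))) : Fin (n - (i + 1) + 1) → ℤ) *
        desuspSign (fun a => D (split (i + 1) n hi (Sum.inl a))) =
      (((n : ℤ) - ((i + 1 : ℕ) : ℤ)) * (2 - ((i + 1 : ℕ) : ℤ))).negOnePow * desuspSign D := by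
  have hc : ((n - (i + 1) : ℕ) : ℤ) = (n : ℤ) - ((i + 1 : ℕ) : ℤ) := by
    rw [Nat.cast_sub hi]
  have e : desuspSign D = (∏ a : Fin (i + 1), (((n : ℤ) - ((a : ℤ) + 1)) *
      D (split (i + 1) n hi (Sum.inl a))).negOnePow) *
      ∏ b : Fin (n - (i + 1)), (((n : ℤ) - (((i + 1 : ℕ) : ℤ) + (b : ℤ) + 1)) *
        D (split (i + 1) n hi (Sum.inr b))).negOnePow := by
    rw [desuspSign, ← Equiv.prod_comp (split (i + 1) n hi), Fintype.prod_sum_type]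
    simp only [split_inl_val, split_inr_val, Nat.cast_add]
  rw [e, desuspSign, desuspSign, Fin.prod_univ_succ]
  simp only [← negOnePow_sum, ← Int.negOnePow_add]
  congr 1
  simp only [Fin.cons_zero, Fin.cons_succ, Fin.val_zero, Fin.val_succ, Nat.cast_add, Nat.cast_one,
    hc, Nat.cast_zero, zero_add]
  rw [mul_add]
  have e1 : ∑ b : Fin (n - (i + 1)), ((n : ℤ) - ((i : ℤ) + 1) + 1 - ((b : ℤ) + 1 + 1)) *
      D (split (i + 1) n hi (Sum.inr b)) = ∑ b : Fin (n - (i + 1)),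
        ((n : ℤ) - ((i : ℤ) + 1 + (b : ℤ) + 1)) * D (split (i + 1) n hi (Sum.inr b)) :=
    Finset.sum_congr rfl fun b _ => by ring
  have e2 : ∑ a : Fin (i + 1), ((n : ℤ) - ((a : ℤ) + 1)) * D (split (i + 1) n hi (Sum.inl a)) =
      ((n : ℤ) - ((i : ℤ) + 1)) * ∑ a, D (split (i + 1) n hi (Sum.inl a)) +
      ∑ a : Fin (i + 1), ((i : ℤ) + 1 - ((a : ℤ) + 1)) * D (split (i + 1) n hi (Sum.inl a)) := by
    rw [Finset.mul_sum, ← Finset.sum_add_distrib]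
    exact Finset.sum_congr rfl fun a _ => by ring
  rw [e1, e2]
  ring

/-- Here the binomial exponent is explained: it turns the sign of `desuspSign_split` into the
`(-1)^(i + 1)` of the Jacobi identity, up to a factor depending only on `n` and the degrees. -/
lemma twistSign_split {n i : ℕ} (hi : i < n) (D : Fin n → ℤ) :
    twistSign (Fin.cons (∑ a, D (split (i + 1) n hi (Sum.inl a)) + (2 - ((i + 1 : ℕ) : ℤ)))
      (fun b => D (split (i + 1) n hi (Sum.inr b))) : Fin (n - (i + 1) + 1) → ℤ) *
        twistSign (fun a => D (split (i + 1) n hi (Sum.inl a))) =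
      (-1) ^ (n + 1) * (-1) ^ (i + 1) * twistSign D := by
  obtain ⟨r, hr⟩ : ∃ r, n - (i + 1) = r := ⟨_, rfl⟩
  have hn : n = r + (i + 1) := by omega
  have hc : (n : ℤ) - ((i + 1 : ℕ) : ℤ) = r := by rw [hn]; push_cast; ring
  -- The outer operation has arity `r + 1` and the inner one arity `i + 1`, with sum `n + 1`.
  have h := choose_two_add (r + 1) (i + 1)
  rw [show r + 1 + (i + 1) + 1 = (n + 1) + 1 by omega, Nat.choose_succ_succ' (n + 1) 1,
    Nat.choose_one_right] at h
  rw [twistSign, twistSign, twistSign, mul_mul_mul_comm, desuspSign_split hi D, hc, ← mul_assoc,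
    ← mul_assoc]
  congr 1
  have h' : ∀ k : ℕ, (-1 : ℤˣ) ^ k = (k : ℤ).negOnePow := fun k => rfl
  rw [hr]
  simp only [h', ← Int.negOnePow_add]
  rw [Int.negOnePow_eq_iff]
  have h2 : (((r + 1 + 1).choose 2 : ℕ) : ℤ) + ((i + 1 + 1).choose 2 : ℕ) +
      ((i : ℤ) + 1) * ((r : ℤ) + 1) = (n : ℤ) + 1 + ((n + 1).choose 2 : ℕ) := by
    exact_mod_cast h
  refine ⟨(r : ℤ) - ((i : ℤ) + 1) * (r + 1), ?_⟩
  push_cast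
  linear_combination h2

end signs

/-! ### `L∞`-structures and differentials -/

section correspondence

variable {K : Type*} [Field K] {V : Type*} [AddCommGroup V] [Module K V]
variable (𝒱 : ℤ → Submodule K V)

variable [DirectSum.Decomposition 𝒱]

/-- The family `v ↦ ± g (v)` with the sign relating `lₙ` to the `n`-th corestriction. -/
def twist (g : ∀ n : ℕ+, MultilinearMap K (fun _ : Fin n => V) V) (n : ℕ+) :
    MultilinearMap K (fun _ : Fin n => V) V :=
  homExt 𝒱 fun d => twistSign d • g n

lemma twist_apply (g : ∀ n : ℕ+, MultilinearMap K (fun _ : Fin n => V) V) (n : ℕ+)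
    (d : Fin n → ℤ) (v : Fin n → V) (hv : ∀ a, v a ∈ 𝒱 (d a)) :
    twist 𝒱 g n v = twistSign d • g n v :=
  homExt_apply 𝒱 _ d v hv

/-- The twisting sign squares to one, so the same operation serves in both directions of the
bijection. -/
lemma twist_twist (g : ∀ n : ℕ+, MultilinearMap K (fun _ : Fin n => V) V) :
    twist 𝒱 (twist 𝒱 g) = g := by
  funext n
  refine multilinear_ext_homogeneous 𝒱 fun d v hv => ?_
  rw [twist_apply 𝒱 _ n d v hv, twist_apply 𝒱 _ n d v hv, smul_smul, Int.units_mul_self, one_smul]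

variable {𝒱}

omit [DirectSum.Decomposition 𝒱] in
lemma cons_units_smul {m : ℕ} (F : MultilinearMap K (fun _ : Fin (m + 1) => V) V) (s : ℤˣ) (x : V)
    (u : Fin m → V) : F (Fin.cons (α := fun _ => V) (s • x) u) =
      s • F (Fin.cons (α := fun _ => V) x u) :=
  congrArg (fun φ => φ u) (map_units_smul F.curryLeft s x)

/-- The degree hypothesis makes the inner value homogeneous, so the outer twisting sign can be
evaluated. The total sign of each term is then that of the Jacobi identity times a factor
independent of `i` and σ. -/
lemma twist_quadratic (g : ∀ n : ℕ+, MultilinearMap K (fun _ : Fin n => V) V)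
    (hg : ∀ (k : ℕ+) (d : Fin k → ℤ) (v : Fin k → V), (∀ a, v a ∈ 𝒱 (d a)) →
      g k v ∈ 𝒱 (∑ a, d a + (2 - (k : ℤ)))) {n : ℕ} (d : Fin n → ℤ) (v : Fin n → V)
    (hv : ∀ a, v a ∈ 𝒱 (d a)) :
    (∑ i : Fin n, ∑ σ ∈ unshuffles (i + 1) n i.2, koszul σ (fun a => d a - 1) •
      twist 𝒱 g (Nat.succPNat (n - (i + 1))) (Fin.cons (α := fun _ => V)
        (twist 𝒱 g (Nat.succPNat i) fun a => v (σ (split (i + 1) n i.2 (Sum.inl a))))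
        fun b => v (σ (split (i + 1) n i.2 (Sum.inr b))))) =
    ((-1) ^ (n + 1) * twistSign d) • ∑ i : Fin n, (-1 : ℤˣ) ^ ((i : ℕ) + 1) •
      ∑ σ ∈ unshuffles (i + 1) n i.2, antiKoszul σ d •
        g (Nat.succPNat (n - (i + 1))) (Fin.cons (α := fun _ => V)
          (g (Nat.succPNat i) fun a => v (σ (split (i + 1) n i.2 (Sum.inl a))))
          fun b => v (σ (split (i + 1) n i.2 (Sum.inr b)))) := by
  rw [Finset.smul_sum]
  refine Finset.sum_congr rfl fun i _ => ?_
  rw [Finset.smul_sum, Finset.smul_sum]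
  refine Finset.sum_congr rfl fun σ _ => ?_
  have h1 := twist_apply 𝒱 g (Nat.succPNat i)
    (fun a => d (σ (split (i + 1) n i.2 (Sum.inl a))))
    (fun a => v (σ (split (i + 1) n i.2 (Sum.inl a)))) (fun a => hv _)
  have hx := hg (Nat.succPNat i) (fun a => d (σ (split (i + 1) n i.2 (Sum.inl a))))
    (fun a => v (σ (split (i + 1) n i.2 (Sum.inl a)))) (fun a => hv _)
  have h2 := twist_apply 𝒱 g (Nat.succPNat (n - (i + 1))) (Fin.cons (α := fun _ => ℤ) _
      (fun b => d (σ (split (i + 1) n i.2 (Sum.inr b)))))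
    (Fin.cons (α := fun _ => V) _ (fun b => v (σ (split (i + 1) n i.2 (Sum.inr b)))))
    (Fin.cases hx fun b => hv _)
  have h3 : ∀ (s : ℤˣ) (x : V), twist 𝒱 g (Nat.succPNat (n - (i + 1)))
      (Fin.cons (α := fun _ => V) (s • x) fun b => v (σ (split (i + 1) n i.2 (Sum.inr b)))) =
      s • twist 𝒱 g (Nat.succPNat (n - (i + 1)))
      (Fin.cons (α := fun _ => V) x fun b => v (σ (split (i + 1) n i.2 (Sum.inr b)))) :=
    fun s x => cons_units_smul _ s x _
  have h4 := twistSign_split i.2 (d ∘ σ)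
  rw [h1, h3, h2, smul_smul, smul_smul, smul_smul, smul_smul]
  refine congrArg (fun s : ℤˣ => s • g (Nat.succPNat (n - (i + 1))) (Fin.cons (α := fun _ => V)
          (g (Nat.succPNat i) fun a => v (σ (split (i + 1) n i.2 (Sum.inl a))))
          fun b => v (σ (split (i + 1) n i.2 (Sum.inr b))))) ?_
  refine (mul_assoc _ _ _).trans ?_
  refine (congrArg (koszul σ (fun a => d a - 1) * ·) ((mul_comm _ _).trans h4)).trans ?_
  rw [mul_left_comm, koszul_mul_twistSign]
  ac_rfl

lemma LInfStructure.isSymmFamily (L : LInfStructure 𝒱) :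
    IsSymmFamily (desusp 𝒱) (twist 𝒱 L.l) where
  degree n d w hw := by
    rw [twist_apply 𝒱 L.l n (fun a => d a + 1) w hw, Units.smul_def]
    refine zsmul_mem ?_ _
    have := L.degree n (fun a => d a + 1) w hw
    rw [Finset.sum_add_distrib] at this
    simp only [Finset.sum_const, Finset.card_univ, Fintype.card_fin, nsmul_eq_mul, mul_one] at this
    rwa [show ∑ a, d a + (n : ℤ) + (2 - (n : ℤ)) = ∑ a, d a + 1 + 1 by ring] at this
  symm n d w hw σ := by
    rw [twist_apply 𝒱 L.l n (fun a => d a + 1) w hw,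
      twist_apply 𝒱 L.l n ((fun a => d a + 1) ∘ σ) (w ∘ σ) (fun a => hw (σ a)),
      L.antisymm n (fun a => d a + 1) w hw, smul_smul, smul_smul]
    have := koszul_mul_twistSign σ (fun a => d a + 1)
    simp only [add_sub_cancel_right] at this
    rw [this, mul_comm (antiKoszul _ _), mul_assoc, Int.units_mul_self, mul_one]

lemma IsCoderivation.twist_degree {θ : CExt (desusp 𝒱) →ₗ[K] CExt (desusp 𝒱)}
    (hθ : IsCoderivation (desusp 𝒱) 1 θ) (k : ℕ+) (d : Fin k → ℤ) (v : Fin k → V)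
    (hv : ∀ a, v a ∈ 𝒱 (d a)) :
    twist 𝒱 (corestriction (desusp 𝒱) θ) k v ∈ 𝒱 (∑ a, d a + (2 - (k : ℤ))) := by
  rw [twist_apply 𝒱 _ k d v hv, Units.smul_def]
  refine zsmul_mem ?_ _
  have := hθ.isSymmFamily.degree k (fun a => d a - 1) v
    (fun a => by simpa only [desusp, sub_add_cancel] using hv a)
  rw [Finset.sum_sub_distrib, desusp] at this
  simp only [Finset.sum_const, Finset.card_univ, Fintype.card_fin, nsmul_eq_mul, mul_one] at this
  rwa [show ∑ a, d a - (k : ℤ) + 1 + 1 = ∑ a, d a + (2 - (k : ℤ)) by ring] at this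

variable [CharZero K]

lemma LInfStructure.coderivation_mem (L : LInfStructure 𝒱) :
    coderivation L.isSymmFamily ∈ CoDiff (desusp 𝒱) := by
  refine ⟨coderivation_isCoderivation _, ?_⟩
  rw [coderivation_comp_self_eq_zero_iff]
  intro n d w hw
  by_cases hn : 1 ≤ n
  · have := twist_quadratic L.l L.degree (fun a => d a + 1) w hw
    simp only [add_sub_cancel_right] at this
    rw [this, L.jacobi n hn _ w hw, smul_zero]
  -- The Jacobi identities start at `n = 1`; for `n = 0` the quadratic relation is an empty sum.
  · obtain rfl : n = 0 := by omega
    simp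

/-- The `L∞`-structure of a differential. -/
def CoDiff.toLInf (θ : CoDiff (desusp 𝒱)) : LInfStructure 𝒱 where
  l := twist 𝒱 (corestriction (desusp 𝒱) θ.1)
  degree := θ.2.1.twist_degree
  antisymm k d v hv σ := by
    have h := θ.2.1.isSymmFamily.symm k (fun a => d a - 1) v
      (fun a => by simpa only [desusp, sub_add_cancel] using hv a) σ
    rw [twist_apply 𝒱 _ k d v hv, twist_apply 𝒱 _ k (d ∘ σ) (v ∘ σ) (fun a => hv _), h, smul_smul,
      smul_smul, ← koszul_mul_twistSign, mul_comm (koszul _ _), mul_assoc, Int.units_mul_self,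
      mul_one]
  jacobi n _ d v hv := by
    have h := twist_quadratic _ θ.2.1.twist_degree d v hv
    have h0 : coderivation θ.2.1.isSymmFamily ∘ₗ coderivation θ.2.1.isSymmFamily = 0 := by
      rw [θ.2.1.eq_coderivation]
      exact θ.2.2
    -- The relation is applied to the twisted family, whose own twist is the family of
    -- corestrictions; the global sign is invertible.
    rw [twist_twist, (coderivation_comp_self_eq_zero_iff θ.2.1.isSymmFamily).mp h0 n
      (fun a => d a - 1) v (fun a => by simpa only [desusp, sub_add_cancel] using hv a)] at h
    exact (smul_eq_zero_iff_eq _).mp h.symm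

/-- The bijection between `L∞`-structures and differentials. -/
def lInfEquivCoDiff : LInfStructure 𝒱 ≃ CoDiff (desusp 𝒱) where
  toFun L := ⟨coderivation L.isSymmFamily, L.coderivation_mem⟩
  invFun := CoDiff.toLInf
  left_inv L := by
    refine LInfStructure.ext ?_
    change twist 𝒱 (corestriction (desusp 𝒱) (coderivation L.isSymmFamily)) = L.l
    rw [funext fun n => corestriction_coderivation L.isSymmFamily n, twist_twist]
  right_inv θ := by
    refine Subtype.ext ?_
    refine (coderivation_isCoderivation (CoDiff.toLInf θ).isSymmFamily).ext_corestriction θ.2.1 fun n => ?_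
    refine (corestriction_coderivation (CoDiff.toLInf θ).isSymmFamily n).trans ?_
    change twist 𝒱 (twist 𝒱 (corestriction (desusp 𝒱) θ.1)) n = _
    rw [twist_twist]

end correspondence

end LInfty

end

theorem mainTheorem8 {K : Type*} [Field K] [CharZero K] {V : Type*} [AddCommGroup V] [Module K V]
    (𝒱 : ℤ → Submodule K V) [DirectSum.Decomposition 𝒱] :
    ∃ Φ : LInfty.LInfStructure 𝒱 ≃ LInfty.CoDiff (LInfty.desusp 𝒱),
      ∀ (L : LInfty.LInfStructure 𝒱) (n : ℕ+) (d : Fin n → ℤ) (v : Fin n → V),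
        (∀ a, v a ∈ 𝒱 (d a)) →
        L.l n v = (-1 : ℤˣ) ^ (((n : ℕ) + 1).choose 2) • LInfty.desuspSign d •
          LInfty.corestriction (LInfty.desusp 𝒱) (Φ L : _ →ₗ[K] _) n v := by
  refine ⟨LInfty.lInfEquivCoDiff, fun L n d v hv => ?_⟩
  change _ = _ • _ • LInfty.corestriction _ (LInfty.coderivation L.isSymmFamily) n v
  rw [LInfty.corestriction_coderivation, smul_smul]
  change _ = LInfty.twistSign d • _
  rw [LInfty.twist_apply 𝒱 L.l n d v hv, smul_smul, Int.units_mul_self, one_smul]
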